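/- **Notation.** Let $0\le k\le n$, let $a=\mathrm{diag}(\tfrac i2 I_k,-\tfrac i2 I_{n-k})$, and equip $u(n)$ with $\langle y,z\rangle=-\mathrm{tr}(yz)$. Let $Gr(k,n)\subset u(n)$ be the adjoint $U(n)$-orbit of $a$ with the induced metric, its Levi-Civita connection $\nabla$ (the tangential part of the ordinary derivative) and complex structure $J_y(v)=[y,v]$. Let $C_a$ be the space of smooth $\gamma:\mathbb R\to Gr(k,n)$ with $\gamma(-\infty)=a$ and $\gamma_x$ in the Schwartz class, and let $\hat\tau_\gamma(X,Y)=\int_{\mathbb R}\langle J_\gamma X,Y\rangle\,dx$. Let $u(n)_a^\perp$ be the orthogonal complement in $u(n)$ of the centralizer of $a$. For $\gamma\in C_a$ let $g:\mathbb R\to U(n)$ be the smooth map with $\gamma=gag^{-1}$, $g(-\infty)=I$ and $\Phi(\gamma):=g^{-1}g_x$ a Schwartz map into $u(n)_a^\perp$. For $u=\Phi(\gamma)$ let $Q_j=Q_j(u):\mathbb R\to u(n)$, $j\ge 0$, be the smooth maps with $Q_0=a$, $Q_j(-\infty)=0$ for $j\ge1$, and $(Q_j)_x+[u,Q_j]=[Q_{j+1},a]$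 for $j\ge 0$. For $j\ge0$ put $H_j(\gamma)=\frac1{j+1}\int_{\mathbb R}\mathrm{tr}\big(Q_{j+2}(\Phi(\gamma))\,a\big)\,dx$. A tangent vector of $C_a$ at $\gamma$ is a smooth vector field $X$ along $\gamma$, tangent to $Gr(k,n)$, with $X(-\infty)=0$ and $X_x$ Schwartz. A smooth curve $s\mapsto\Gamma_s$ in $C_a$ is a jointly smooth family of elements of $C_a$ such that all $s$-derivatives of $\partial_x\Gamma_s$ satisfy the Schwartz bounds uniformly for $|s|\le1$. A Hamiltonian vector of $H_j$ at $\gamma$ is a tangent vector $X$ such that, for every smooth curve with $\Gamma_0=\gamma$ and velocity $\delta\gamma=\partial_s\Gamma_s|_{s=0}$, the integral $\hat\tau_\gamma(X,\delta\gamma)$ converges absolutely and $\frac{d}{ds}\big|_{s=0}H_j(\Gamma_s)=\hat\tau_\gamma(X,\delta\gamma)$. A solution of the Hamiltonian flow of $H_j$ is a family $t\mapsto\gamma(t,\cdot)\in C_a$ whose $t$-derivative $\gamma_t$ is at each time a Hamiltonian vector of $H_j$. **Proposition 4.4.** There are noncommutative polynomials (with respect to the matrix product, with real coefficients) $P_j$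 ($j\ge1$), in the letters $\nabla^m_{\gamma_x}\gamma_x,\ J_\gamma(\nabla^m_{\gamma_x}\gamma_x)$ with $0\le m\le j-1$, and $R_j,S_j$ ($j\ge0$), in the same letters with $0\le m\le j+1$, none of them depending on $k$, $n$ or $\gamma$, such that for all $0\le k\le n$ and $\gamma\in C_a$: 1. the map $g$ and the sequence $(Q_j)_{j\ge0}$ exist and are unique, and for all $j\ge1$ $$g\,Q_j(\Phi(\gamma))\,g^{-1}=P_j\big(\nabla^m_{\gamma_x}\gamma_x,\;J_\gamma(\nabla^m_{\gamma_x}\gamma_x)\;:\;0\le m\le j-1\big);$$ 2. for all $j\ge0$, the integral defining $H_j(\gamma)$ converges absolutely, and $H_j(\gamma)=\int_{\mathbb R}\mathrm{Re}\,\mathrm{tr}\,R_j(\nabla^m_{\gamma_x}\gamma_x,J_\gamma\nabla^m_{\gamma_x}\gamma_x)\,dx$, also absolutely convergent; 3. for all $j\ge0$, $H_j$ has exactly one Hamiltonian vector at $\gamma$ with respect to $\hat\tau$, namely $g[Q_{j+2}(\Phi(\gamma)),a]g^{-1}=S_j(\nabla^m_{\gamma_x}\gamma_x,J_\gamma\nabla^m_{\gamma_x}\gamma_x)$;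 accordingly, a family $t\mapsto\gamma(t,\cdot)\in C_a$ is a solution of the Hamiltonian flow of $H_j$ if and only if $\gamma_t=S_j(\nabla^m_{\gamma_x}\gamma_x,J_\gamma\nabla^m_{\gamma_x}\gamma_x)$; 4. the Hamiltonians Poisson commute: the Hamiltonian vectors $X_i,X_j$ of $H_i,H_j$ at $\gamma$ satisfy $\hat\tau_\gamma(X_i,X_j)=0$ (an absolutely convergent integral) for all $i,j\ge0$. Thus the commuting Hamiltonians $H_j$ and their flows are expressed through the covariant derivative and the complex structure of $Gr(k,n)$. -/

import Mathlib

open scoped SchwartzMap Topology ContDiff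
open scoped Matrix.Norms.L2Operator

namespace GrassmannFlow

noncomputable section

/-- Complex `n × n` matrices (normed by the operator norm). -/
abbrev Mat (n : ℕ) : Type := Matrix (Fin n) (Fin n) ℂ

/-- The Lie algebra `u(n)` of skew-Hermitian matrices. -/
abbrev u (n : ℕ) : AddSubgroup (Mat n) := skewAdjoint (Mat n)

/-- The invariant inner product `⟨y, z⟩ = - tr (y z)` of `u(n)` (the trace is real there). -/
def ip {n : ℕ} (y z : Mat n) : ℝ := -(Matrix.trace (y * z)).re

/-- `a = diag (i/2, …, i/2, -i/2, …, -i/2)` with `k` entries `i/2` and `n - k` entries `-i/2`. -/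
def base (n k : ℕ) : Mat n :=
  Matrix.diagonal fun i => if (i : ℕ) < k then Complex.I / 2 else -(Complex.I / 2)

/-- The Grassmannian `Gr(k,n)`: the adjoint `U(n)`-orbit of `a` in `u(n)`. -/
def Gr (n k : ℕ) : Set (Mat n) :=
  {y | ∃ h ∈ Matrix.unitaryGroup (Fin n) ℂ, y = h * base n k * h⁻¹}

/-- The tangent space at `y` of the adjoint orbit of `y`: all `[z, y]` with `z ∈ u(n)`. -/
def tangent {n : ℕ} (y : Mat n) : Set (Mat n) := {v | ∃ z ∈ u n, v = ⁅z, y⁆}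

/-- The complex structure `J_y v = [y, v]` of the Grassmannian. -/
def J {n : ℕ} (y v : Mat n) : Mat n := ⁅y, v⁆

/-- The orthogonal projection of `u(n)` onto the tangent space of the Grassmannian at `y`;
see `tangentProj_mem`, `tangentProj_orthogonal`. -/
def tangentProj {n : ℕ} (y v : Mat n) : Mat n := -⁅y, ⁅y, v⁆⁆

/-- The Levi-Civita covariant derivative, for the metric induced from `ip`, of a vector field `V`
along the curve `γ` in the direction `γ_x`: the tangential part of `V_x`. -/
def covDeriv {n : ℕ} (γ V : ℝ → Mat n) : ℝ → Mat n := fun x => tangentProj (γ x) (deriv V x)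

/-- The iterated covariant derivative `∇^m_{γ_x} γ_x`. -/
def nablaPow {n : ℕ} (γ : ℝ → Mat n) (m : ℕ) : ℝ → Mat n := (covDeriv γ)^[m] (deriv γ)

/-- The map `f` belongs to the Schwartz class. -/
def IsSchwartz {n : ℕ} (f : ℝ → Mat n) : Prop := ∃ φ : 𝓢(ℝ, Mat n), ∀ x, φ x = f x

/-- The phase space `C_a(ℝ, Gr(k,n))`: smooth paths `γ` in `Gr(k,n)` with `γ(-∞) = a` and `γ_x`
in the Schwartz class. -/
def PathSpace (n k : ℕ) : Set (ℝ → Mat n) :=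
  {γ | ContDiff ℝ ∞ γ ∧ (∀ x, γ x ∈ Gr n k) ∧ Filter.Tendsto γ Filter.atBot (𝓝 (base n k)) ∧
    IsSchwartz (deriv γ)}

/-- `u(n)_a^⊥`: the orthogonal complement in `u(n)` of the centralizer `u(n)_a` of `a`. -/
def centPerp (n k : ℕ) : Set (Mat n) :=
  {y | y ∈ u n ∧ ∀ z ∈ u n, ⁅z, base n k⁆ = 0 → ip y z = 0}

/-- `g : ℝ → U(n)` satisfies `γ = g a g⁻¹`, `g(-∞) = I`, and `g⁻¹ g_x` is a Schwartz map into
`u(n)_a^⊥`. -/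
structure IsFrame (n k : ℕ) (γ g : ℝ → Mat n) : Prop where
  smooth : ContDiff ℝ ∞ g
  unitary : ∀ x, g x ∈ Matrix.unitaryGroup (Fin n) ℂ
  conj : ∀ x, γ x = g x * base n k * (g x)⁻¹
  lim : Filter.Tendsto g Filter.atBot (𝓝 1)
  perp : ∀ x, (g x)⁻¹ * deriv g x ∈ centPerp n k
  schwartz : IsSchwartz fun x => (g x)⁻¹ * deriv g x

/-- The frame `g` of the path `γ` (an arbitrary map if there is none). -/
def frame (n k : ℕ) (γ : ℝ → Mat n) : ℝ → Mat n := Classical.epsilon (IsFrame n k γ)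

/-- The development map `Φ(γ) = g⁻¹ g_x`. -/
def Phi (n k : ℕ) (γ : ℝ → Mat n) : ℝ → Mat n :=
  fun x => (frame n k γ x)⁻¹ * deriv (frame n k γ) x

/-- The sequence `Q_j = Q_j(w)` of the `u(n)`-hierarchy at `w : ℝ → u(n)_a^⊥`: smooth maps
`Q_j : ℝ → u(n)` with `Q_0 = a`, `Q_j(-∞) = 0` for `j ≥ 1`, and
`(Q_j)_x + [w, Q_j] = [Q_{j+1}, a]`. -/
structure IsHierarchy (n k : ℕ) (w : ℝ → Mat n) (Q : ℕ → ℝ → Mat n) : Prop where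
  smooth : ∀ j, ContDiff ℝ ∞ (Q j)
  mem : ∀ j x, Q j x ∈ u n
  zero : ∀ x, Q 0 x = base n k
  lim : ∀ j, 1 ≤ j → Filter.Tendsto (Q j) Filter.atBot (𝓝 0)
  step : ∀ j x, deriv (Q j) x + ⁅w x, Q j x⁆ = ⁅Q (j + 1) x, base n k⁆

/-- The sequence `j ↦ Q_j(w)` (an arbitrary sequence if there is none). -/
def Qseq (n k : ℕ) (w : ℝ → Mat n) : ℕ → ℝ → Mat n := Classical.epsilon (IsHierarchy n k w)

/-- `F_j(w) = (j+1)⁻¹ ∫ tr (Q_{j+2}(w) a) dx` (the trace is real). -/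
def F (n k j : ℕ) (w : ℝ → Mat n) : ℝ :=
  ((j : ℝ) + 1)⁻¹ * ∫ x, (Matrix.trace (Qseq n k w (j + 2) x * base n k)).re

/-- The Hamiltonian `H_j = F_j ∘ Φ` on the path space. -/
def H (n k j : ℕ) (γ : ℝ → Mat n) : ℝ := F n k j (Phi n k γ)

/-- Evaluation at the point `x`, with respect to the matrix product, of a noncommutative polynomial
in the letters `inl m ↦ ∇^m_{γ_x} γ_x` and `inr m ↦ J_γ (∇^m_{γ_x} γ_x)`, `m < r`. -/
def evalAlong {n r : ℕ} (γ : ℝ → Mat n) (x : ℝ) (p : FreeAlgebra ℝ (Fin r ⊕ Fin r)) : Mat n :=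
  FreeAlgebra.lift ℝ
    (Sum.elim (fun m : Fin r => nablaPow γ m x) (fun m : Fin r => J (γ x) (nablaPow γ m x))) p

/-- The integrand of the symplectic form `τ̂`, i.e. `⟨J_γ X, Y⟩`. -/
def tauDensity {n : ℕ} (γ X Y : ℝ → Mat n) (x : ℝ) : ℝ := ip (J (γ x) (X x)) (Y x)

/-- The symplectic form `τ̂_γ (X, Y) = ∫ ⟨J_γ X, Y⟩ dx` of the path space. -/
def tau {n : ℕ} (γ X Y : ℝ → Mat n) : ℝ := ∫ x, tauDensity γ X Y x

/-- `X` is a tangent vector of the path space at `γ`: a smooth vector field along `γ` tangent to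
the Grassmannian, with `X(-∞) = 0` and `X_x` in the Schwartz class. -/
structure IsTangentField {n : ℕ} (γ X : ℝ → Mat n) : Prop where
  smooth : ContDiff ℝ ∞ X
  mem : ∀ x, X x ∈ tangent (γ x)
  lim : Filter.Tendsto X Filter.atBot (𝓝 0)
  schwartz : IsSchwartz (deriv X)

/-- `s ↦ Γ s` is a smooth curve in the path space with `Γ 0 = γ`: all derivatives in `s` of the
`x`-derivative of `Γ` satisfy the Schwartz bounds, uniformly for `s` near `0`. -/
structure IsVariation (n k : ℕ) (γ : ℝ → Mat n) (Γ : ℝ → ℝ → Mat n) : Prop where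
  smooth : ContDiff ℝ ∞ fun p : ℝ × ℝ => Γ p.1 p.2
  mem : ∀ s, Γ s ∈ PathSpace n k
  zero : Γ 0 = γ
  bound : ∀ i m p : ℕ, ∃ C : ℝ, ∀ s ∈ Set.Icc (-1 : ℝ) 1, ∀ x : ℝ,
    |x| ^ p * ‖iteratedDeriv (m + 1) (fun y => iteratedDeriv i (fun r => Γ r y) s) x‖ ≤ C

/-- The initial velocity `δγ` of a variation. -/
def velocity {n : ℕ} (Γ : ℝ → ℝ → Mat n) : ℝ → Mat n := fun x => deriv (fun s => Γ s x) 0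

/-- `X` is the value at `γ` of the Hamiltonian vector field of the functional `h` with respect to
`τ̂`: a tangent vector at `γ` with `dh_γ (δγ) = τ̂_γ (X, δγ)` for every variation of `γ`. -/
structure IsHamiltonianField (n k : ℕ) (h : (ℝ → Mat n) → ℝ) (γ X : ℝ → Mat n) : Prop where
  tangent : IsTangentField γ X
  integrable : ∀ Γ, IsVariation n k γ Γ → MeasureTheory.Integrable (tauDensity γ X (velocity Γ))
  differential : ∀ Γ, IsVariation n k γ Γ →
    HasDerivAt (fun s => h (Γ s)) (tau γ X (velocity Γ)) 0

/-- `t ↦ Γ t`, `t ∈ I`, is a solution in the path space of the Hamiltonian equation (flow) of the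
functional `h` with respect to `τ̂`. -/
def IsHamiltonianFlow (n k : ℕ) (h : (ℝ → Mat n) → ℝ) (I : Set ℝ) (Γ : ℝ → ℝ → Mat n) : Prop :=
  ∀ t ∈ I, Γ t ∈ PathSpace n k ∧ ∃ X : ℝ → Mat n, IsHamiltonianField n k h (Γ t) X ∧
    ∀ x, HasDerivAt (fun s => Γ s x) (X x) t

/-! The projection `tangentProj` is the orthogonal projection onto the tangent space. -/

lemma base_sq (n k : ℕ) : base n k * base n k = -((1 / 4 : ℂ) • (1 : Mat n)) := by
  have h : Complex.I * Complex.I = -1 := Complex.I_mul_I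
  ext i j
  rw [base, Matrix.diagonal_mul_diagonal]
  by_cases hij : i = j
  · subst hij
    simp only [Matrix.diagonal_apply_eq, Matrix.neg_apply, Matrix.smul_apply, Matrix.one_apply_eq,
      smul_eq_mul]
    split_ifs <;> linear_combination (1 / 4 : ℂ) * h
  · simp [hij]

lemma base_mem (n k : ℕ) : base n k ∈ u n := by
  rw [skewAdjoint.mem_iff, Matrix.star_eq_conjTranspose, base, Matrix.diagonal_conjTranspose]
  ext i j
  by_cases hij : i = j
  · subst hij
    simp only [Matrix.diagonal_apply_eq, Matrix.neg_apply, Pi.star_apply]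
    split_ifs <;> simp [neg_div]
  · simp [hij]

lemma gr_sq {n k : ℕ} {y : Mat n} (hy : y ∈ Gr n k) : y * y = -((1 / 4 : ℂ) • (1 : Mat n)) := by
  obtain ⟨h, hh, rfl⟩ := hy
  have e := (Matrix.mem_unitaryGroup_iff').1 hh
  have e2 := (Matrix.mem_unitaryGroup_iff).1 hh
  rw [Matrix.inv_eq_left_inv e]
  calc h * base n k * star h * (h * base n k * star h)
      = h * (base n k * (star h * h) * base n k) * star h := by noncomm_ring
    _ = _ := by rw [e, mul_one, base_sq]; simp [e2]

lemma gr_mem {n k : ℕ} {y : Mat n} (hy : y ∈ Gr n k) : y ∈ u n := by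
  obtain ⟨h, hh, rfl⟩ := hy
  have e := (Matrix.mem_unitaryGroup_iff').1 hh
  rw [Matrix.inv_eq_left_inv e]
  exact skewAdjoint.conjugate (base_mem n k) h

lemma bracket_mem {n : ℕ} {y v : Mat n} (hy : y ∈ u n) (hv : v ∈ u n) : ⁅y, v⁆ ∈ u n := by
  rw [skewAdjoint.mem_iff] at *
  rw [Ring.lie_def, star_sub, star_mul, star_mul, hy, hv]
  noncomm_ring

lemma tangentProj_mem {n k : ℕ} {y v : Mat n} (hy : y ∈ Gr n k) (hv : v ∈ u n) :
    tangentProj y v ∈ tangent y :=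
  ⟨⁅y, v⁆, bracket_mem (gr_mem hy) hv, by simp only [tangentProj, Ring.lie_def]; noncomm_ring⟩

lemma tangentProj_orthogonal {n k : ℕ} {y : Mat n} (hy : y ∈ Gr n k) (v : Mat n) {w : Mat n}
    (hw : w ∈ tangent y) : ip (v - tangentProj y v) w = 0 := by
  obtain ⟨z, -, rfl⟩ := hw
  have h := gr_sq hy
  have key : ⁅y, v - tangentProj y v⁆ = 0 := by
    have e1 : y * (y * y) * v = -((1 / 4 : ℂ) • (y * v)) := by rw [h]; simp
    have e2 : (y * y) * v * y = -((1 / 4 : ℂ) • (v * y)) := by rw [h]; simp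
    have e3 : y * v * (y * y) = -((1 / 4 : ℂ) • (y * v)) := by rw [h]; simp
    have e4 : v * y * (y * y) = -((1 / 4 : ℂ) • (v * y)) := by rw [h]; simp
    have : ⁅y, v - tangentProj y v⁆ = y * v - v * y + (y * (y * y) * v - 3 • ((y * y) * v * y)
        + 3 • (y * v * (y * y)) - v * y * (y * y)) := by
      simp only [tangentProj, Ring.lie_def]; noncomm_ring
    rw [this, e1, e2, e3, e4]
    module
  have e : Matrix.trace ((v - tangentProj y v) * ⁅z, y⁆) =
      Matrix.trace (⁅y, v - tangentProj y v⁆ * z) := by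
    generalize v - tangentProj y v = b
    rw [Ring.lie_def, Ring.lie_def, mul_sub, sub_mul, Matrix.trace_sub, Matrix.trace_sub,
      ← mul_assoc, Matrix.trace_mul_comm _ y, ← mul_assoc, ← mul_assoc]
  rw [ip, e, key]
  simp

end

end GrassmannFlow

namespace GrassmannFlow

noncomputable section

/-! Conjugation by the frame removes the nonlocality of the hierarchy. For `q_j = g Q_j g⁻¹` the
equations become `q_0 = γ`, `(q_j)_x = [q_{j+1}, γ]`, and the series `q = ∑ q_j λ^j` can be taken
with `q² = -1/4`, as `γ² = -1/4` suggests. The differential equation determines the part of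
`q_{j+1}` anticommuting with `γ`, the coefficient of `λ^{j+1}` in `q² = -1/4` the part commuting
with it. Hence `q_{j+1}` comes from `q_0, …, q_j` by products and one derivative: this is the
recursion `qs`, shown to be consistent in `qs_relations`. The frame solves `g_x = q_1 g`, `g(-∞) =
1`, with integrable `q_1 = 2γγ_x = [γ, γ_x]` (`exists_hasDerivAt_mul_tendsto_one`), and `g⁻¹ q_j g`
is the only solution of the hierarchy (`existsUnique_hierarchy`).

For the Hamiltonians, let `δ` be a variation and `E = λ d/dλ`. Since `q²` is constant, `δq` and `Eq`
anticommute with `q`, and this gives `λ ∂_x tr(q [δq, Eq]) = -tr(δγ Eq) - tr(δq γ)`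
(`trace_total_derivative`). Integrating the coefficient of `λ^{j+2}` over the line yields `δH_j = -∫
tr(q_{j+2} δγ)`, which is the pairing under `τ̂` of `[q_{j+2}, γ]` with `δγ`. Compactly supported
variations show that the Hamiltonian vector is unique. Poisson commutation follows by integrating by
parts, moving indices from one factor to the other until the bracket `[γ, γ] = 0` is reached
(`integral_trace_mul_lie`).

For the polynomials, `γ` is not a letter, but left multiplication by `2γ` exchanges `∇^m γ_x` and `J
∇^m γ_x` up to sign, and the `x`-derivative of a letter is a polynomial in letters
(`deriv_nablaPow`). So the recursion stays among the polynomials without constant term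
(`pathQs_mem`). Working with functions on all paths in all Grassmannians at once makes the
polynomials universal. -/

/-! ### Two-variable calculus -/

/-- The partial derivative in the second variable. -/
def dX {n : ℕ} (f : ℝ → ℝ → Mat n) : ℝ → ℝ → Mat n := fun s x => deriv (f s) x

/-- The partial derivative in the first variable. -/
def dS {n : ℕ} (f : ℝ → ℝ → Mat n) : ℝ → ℝ → Mat n := fun s x => deriv (fun r => f r x) s

/-- Joint smoothness of a curried function. -/
def Smooth2 {n : ℕ} (f : ℝ → ℝ → Mat n) : Prop := ContDiff ℝ ∞ fun p : ℝ × ℝ => f p.1 p.2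

namespace Smooth2

variable {n : ℕ} {f g : ℝ → ℝ → Mat n}

lemma hasDerivAt_right_aux (hf : Smooth2 f) (s x : ℝ) :
    HasDerivAt (f s) (fderiv ℝ (fun p : ℝ × ℝ => f p.1 p.2) (s, x) (0, 1)) x := by
  have h1 : HasFDerivAt (fun p : ℝ × ℝ => f p.1 p.2) _ (s, x) :=
    ((hf.differentiable (by simp)) (s, x)).hasFDerivAt
  exact h1.comp_hasDerivAt x ((hasDerivAt_const x s).prodMk (hasDerivAt_id x))

lemma hasDerivAt_left_aux (hf : Smooth2 f) (s x : ℝ) :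
    HasDerivAt (fun r => f r x) (fderiv ℝ (fun p : ℝ × ℝ => f p.1 p.2) (s, x) (1, 0)) s := by
  have h1 : HasFDerivAt (fun p : ℝ × ℝ => f p.1 p.2) _ (s, x) :=
    ((hf.differentiable (by simp)) (s, x)).hasFDerivAt
  exact h1.comp_hasDerivAt (f := fun r => (r, x)) s
    ((hasDerivAt_id s).prodMk (hasDerivAt_const s x))

lemma hasDerivAt_dX (hf : Smooth2 f) (s x : ℝ) : HasDerivAt (f s) (dX f s x) x :=
  (hf.hasDerivAt_right_aux s x).differentiableAt.hasDerivAt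

lemma hasDerivAt_dS (hf : Smooth2 f) (s x : ℝ) : HasDerivAt (fun r => f r x) (dS f s x) s :=
  (hf.hasDerivAt_left_aux s x).differentiableAt.hasDerivAt

lemma dX_eq (hf : Smooth2 f) (s x : ℝ) :
    GrassmannFlow.dX f s x = fderiv ℝ (fun p : ℝ × ℝ => f p.1 p.2) (s, x) (0, 1) :=
  (hf.hasDerivAt_right_aux s x).deriv

lemma dS_eq (hf : Smooth2 f) (s x : ℝ) :
    GrassmannFlow.dS f s x = fderiv ℝ (fun p : ℝ × ℝ => f p.1 p.2) (s, x) (1, 0) :=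
  (hf.hasDerivAt_left_aux s x).deriv

protected lemma dX (hf : Smooth2 f) : Smooth2 (dX f) := by
  have h : ContDiff ℝ ∞ fun p => fderiv ℝ (fun p : ℝ × ℝ => f p.1 p.2) p ((0 : ℝ), (1 : ℝ)) :=
    (ContDiff.fderiv_right hf (m := ∞) (by simp)).clm_apply contDiff_const
  unfold Smooth2
  simpa only [hf.dX_eq] using h

protected lemma dS (hf : Smooth2 f) : Smooth2 (dS f) := by
  have h : ContDiff ℝ ∞ fun p => fderiv ℝ (fun p : ℝ × ℝ => f p.1 p.2) p ((1 : ℝ), (0 : ℝ)) :=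
    (ContDiff.fderiv_right hf (m := ∞) (by simp)).clm_apply contDiff_const
  unfold Smooth2
  simpa only [hf.dS_eq] using h

lemma dX_dS (hf : Smooth2 f) : dX (dS f) = dS (dX f) := by
  have hd : ∀ p, HasFDerivAt (fderiv ℝ (fun p : ℝ × ℝ => f p.1 p.2))
      (fderiv ℝ (fderiv ℝ (fun p : ℝ × ℝ => f p.1 p.2)) p) p := fun p =>
    (((ContDiff.fderiv_right hf (m := ∞) (by simp)).differentiable (by simp)) p).hasFDerivAt
  have key : ∀ p v w : ℝ × ℝ, fderiv ℝ (fun p => fderiv ℝ (fun p : ℝ × ℝ => f p.1 p.2) p v) p w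
      = fderiv ℝ (fderiv ℝ (fun p : ℝ × ℝ => f p.1 p.2)) p w v := fun p v w => by
    have := (hd p).clm_apply (hasFDerivAt_const v p)
    rw [this.fderiv]; simp
  funext s x
  rw [hf.dS.dX_eq, hf.dX.dS_eq]
  have e1 : (fun p : ℝ × ℝ => GrassmannFlow.dS f p.1 p.2) = _ := funext fun p => hf.dS_eq p.1 p.2
  have e2 : (fun p : ℝ × ℝ => GrassmannFlow.dX f p.1 p.2) = _ := funext fun p => hf.dX_eq p.1 p.2
  rw [e1, e2]
  refine (key (s, x) (1, 0) (0, 1)).trans (Eq.trans ?_ (key (s, x) (0, 1) (1, 0)).symm)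
  exact (ContDiffAt.isSymmSndFDerivAt (n := ∞) (hf.contDiffAt)
    (by rw [minSmoothness_of_isRCLikeNormedField]; exact ENat.LEInfty.out)) _ _

lemma contDiff_right (hf : Smooth2 f) (s : ℝ) : ContDiff ℝ ∞ (f s) :=
  ContDiff.comp (f := fun x : ℝ => (s, x)) hf (by fun_prop)

lemma add (hf : Smooth2 f) (hg : Smooth2 g) : Smooth2 (f + g) := ContDiff.add hf hg

lemma mul (hf : Smooth2 f) (hg : Smooth2 g) : Smooth2 (f * g) := ContDiff.mul hf hg

lemma const_smul (hf : Smooth2 f) (c : ℝ) : Smooth2 (c • f) := ContDiff.const_smul c hf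

lemma zero : Smooth2 (0 : ℝ → ℝ → Mat n) := contDiff_const

lemma of_right {h : ℝ → Mat n} (hh : ContDiff ℝ ∞ h) : Smooth2 fun _ => h := by
  unfold Smooth2; fun_prop

lemma dX_add (hf : Smooth2 f) (hg : Smooth2 g) :
    GrassmannFlow.dX (f + g) = GrassmannFlow.dX f + GrassmannFlow.dX g := by
  funext s x
  exact ((hf.hasDerivAt_dX s x).add (hg.hasDerivAt_dX s x)).deriv

lemma dS_add (hf : Smooth2 f) (hg : Smooth2 g) :
    GrassmannFlow.dS (f + g) = GrassmannFlow.dS f + GrassmannFlow.dS g := by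
  funext s x
  exact ((hf.hasDerivAt_dS s x).add (hg.hasDerivAt_dS s x)).deriv

lemma dX_mul (hf : Smooth2 f) (hg : Smooth2 g) :
    GrassmannFlow.dX (f * g) = GrassmannFlow.dX f * g + f * GrassmannFlow.dX g := by
  funext s x
  exact ((hf.hasDerivAt_dX s x).mul (hg.hasDerivAt_dX s x)).deriv

lemma dS_mul (hf : Smooth2 f) (hg : Smooth2 g) :
    GrassmannFlow.dS (f * g) = GrassmannFlow.dS f * g + f * GrassmannFlow.dS g := by
  funext s x
  exact ((hf.hasDerivAt_dS s x).mul (hg.hasDerivAt_dS s x)).deriv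

lemma dX_const_smul (hf : Smooth2 f) (c : ℝ) :
    GrassmannFlow.dX (c • f) = c • GrassmannFlow.dX f := by
  funext s x
  exact ((hf.hasDerivAt_dX s x).const_smul c).deriv

lemma dS_const_smul (hf : Smooth2 f) (c : ℝ) :
    GrassmannFlow.dS (c • f) = c • GrassmannFlow.dS f := by
  funext s x
  exact ((hf.hasDerivAt_dS s x).const_smul c).deriv

lemma iter_dS (hf : Smooth2 f) (i : ℕ) : Smooth2 (GrassmannFlow.dS^[i] f) := by
  induction i with
  | zero => exact hf
  | succ i ih => rw [Function.iterate_succ_apply']; exact ih.dS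

lemma iter_dX (hf : Smooth2 f) (m : ℕ) : Smooth2 (GrassmannFlow.dX^[m] f) := by
  induction m with
  | zero => exact hf
  | succ m ih => rw [Function.iterate_succ_apply']; exact ih.dX

lemma iter_dS_dX (hf : Smooth2 f) (i : ℕ) :
    GrassmannFlow.dS^[i] (GrassmannFlow.dX f) = GrassmannFlow.dX (GrassmannFlow.dS^[i] f) := by
  induction i with
  | zero => rfl
  | succ i ih =>
    rw [Function.iterate_succ_apply', ih, Function.iterate_succ_apply', (hf.iter_dS i).dX_dS]

lemma iter_add (hf : Smooth2 f) (hg : Smooth2 g) (i m : ℕ) :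
    GrassmannFlow.dX^[m] (GrassmannFlow.dS^[i] (f + g)) =
      GrassmannFlow.dX^[m] (GrassmannFlow.dS^[i] f) +
        GrassmannFlow.dX^[m] (GrassmannFlow.dS^[i] g) := by
  have h1 : ∀ i, GrassmannFlow.dS^[i] (f + g) =
      GrassmannFlow.dS^[i] f + GrassmannFlow.dS^[i] g := by
    intro i
    induction i with
    | zero => rfl
    | succ i ih =>
      simp only [Function.iterate_succ_apply']
      rw [ih, (hf.iter_dS i).dS_add (hg.iter_dS i)]
  rw [h1]
  induction m with
  | zero => rfl
  | succ m ih =>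
    simp only [Function.iterate_succ_apply']
    rw [ih, ((hf.iter_dS i).iter_dX m).dX_add ((hg.iter_dS i).iter_dX m)]

lemma iter_const_smul (hf : Smooth2 f) (c : ℝ) (i m : ℕ) :
    GrassmannFlow.dX^[m] (GrassmannFlow.dS^[i] (c • f)) =
      c • GrassmannFlow.dX^[m] (GrassmannFlow.dS^[i] f) := by
  have h1 : ∀ i, GrassmannFlow.dS^[i] (c • f) = c • GrassmannFlow.dS^[i] f := by
    intro i
    induction i with
    | zero => rfl
    | succ i ih =>
      simp only [Function.iterate_succ_apply']
      rw [ih, (hf.iter_dS i).dS_const_smul]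
  rw [h1]
  induction m with
  | zero => rfl
  | succ m ih =>
    simp only [Function.iterate_succ_apply']
    rw [ih, ((hf.iter_dS i).iter_dX m).dX_const_smul]

end Smooth2

/-! ### Classes of families with decay uniform in the parameter -/

/-- `f` is smooth, and each of its partial derivatives is `O(|x|⁻ᵖ)`, `p ∈ P`, uniformly for
`|s| ≤ 1`. -/
structure Decays {n : ℕ} (P : Set ℕ) (f : ℝ → ℝ → Mat n) : Prop where
  smooth : Smooth2 f
  bound : ∀ i m : ℕ, ∀ p ∈ P, ∃ C : ℝ, ∀ s ∈ Set.Icc (-1 : ℝ) 1, ∀ x : ℝ,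
    |x| ^ p * ‖dX^[m] (dS^[i] f) s x‖ ≤ C

/-- All partial derivatives of `f` are bounded, uniformly for `|s| ≤ 1`. -/
abbrev Tame {n : ℕ} (f : ℝ → ℝ → Mat n) : Prop := Decays {0} f

/-- All partial derivatives of `f` decay rapidly, uniformly for `|s| ≤ 1`. -/
abbrev Rapid {n : ℕ} (f : ℝ → ℝ → Mat n) : Prop := Decays Set.univ f

namespace Decays

variable {n : ℕ} {P : Set ℕ} {f g : ℝ → ℝ → Mat n}

lemma tame (hf : Rapid f) : Tame f := ⟨hf.smooth, fun i m p _ => hf.bound i m p trivial⟩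

protected lemma dS (hf : Decays P f) : Decays P (dS f) :=
  ⟨hf.smooth.dS, fun i m p hp => by
    simpa only [Function.iterate_succ_apply] using hf.bound (i + 1) m p hp⟩

protected lemma dX (hf : Decays P f) : Decays P (dX f) :=
  ⟨hf.smooth.dX, fun i m p hp => by
    rw [hf.smooth.iter_dS_dX]
    simpa only [Function.iterate_succ_apply] using hf.bound i (m + 1) p hp⟩

lemma add (hf : Decays P f) (hg : Decays P g) : Decays P (f + g) := by
  refine ⟨hf.smooth.add hg.smooth, fun i m p hp => ?_⟩
  obtain ⟨C, hC⟩ := hf.bound i m p hp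
  obtain ⟨D, hD⟩ := hg.bound i m p hp
  refine ⟨C + D, fun s hs x => ?_⟩
  rw [hf.smooth.iter_add hg.smooth]
  calc _ ≤ |x| ^ p * (‖dX^[m] (dS^[i] f) s x‖ + ‖dX^[m] (dS^[i] g) s x‖) := by
        gcongr; exact norm_add_le _ _
    _ ≤ _ := by rw [mul_add]; exact add_le_add (hC s hs x) (hD s hs x)

lemma const_smul (hf : Decays P f) (c : ℝ) : Decays P (c • f) := by
  refine ⟨hf.smooth.const_smul c, fun i m p hp => ?_⟩
  obtain ⟨C, hC⟩ := hf.bound i m p hp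
  refine ⟨|c| * C, fun s hs x => ?_⟩
  rw [hf.smooth.iter_const_smul]
  calc _ = |c| * (|x| ^ p * ‖dX^[m] (dS^[i] f) s x‖) := by
        simp only [Pi.smul_apply, norm_smul, Real.norm_eq_abs]; ring
    _ ≤ _ := by gcongr; exact hC s hs x

lemma neg (hf : Decays P f) : Decays P (-f) := by
  simpa using hf.const_smul (-1)

lemma sub (hf : Decays P f) (hg : Decays P g) : Decays P (f - g) := by
  simpa [sub_eq_add_neg] using hf.add hg.neg

lemma zero : Decays P (0 : ℝ → ℝ → Mat n) := by
  have h := Smooth2.zero (n := n)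
  refine ⟨h, fun i m p _ => ⟨0, fun s _ x => ?_⟩⟩
  have := h.iter_const_smul 0 i m
  rw [zero_smul, zero_smul] at this
  simp [this]

lemma sum {ι : Type*} {t : Finset ι} {F : ι → ℝ → ℝ → Mat n} (h : ∀ i ∈ t, Decays P (F i)) :
    Decays P (∑ i ∈ t, F i) := by
  classical
  induction t using Finset.induction_on with
  | empty => simpa using zero
  | insert a t ha ih =>
    rw [Finset.sum_insert ha]
    exact (h a (by simp)).add (ih fun i hi => h i (by simp [hi]))

/-- The Leibniz rule, peeled off one derivative at a time; the factors change at each step, so the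
induction quantifies over them. The weight `|x| ^ p` is split between the factors only when no
derivative is left. -/
lemma mul_aux (Q : Set ℕ) (p : ℕ) (i m : ℕ) : ∀ {f g : ℝ → ℝ → Mat n}, Decays P f → Decays Q g →
    (∃ q ∈ P, ∃ r ∈ Q, q + r = p) → ∃ C : ℝ, ∀ s ∈ Set.Icc (-1 : ℝ) 1, ∀ x : ℝ,
      |x| ^ p * ‖dX^[m] (dS^[i] (f * g)) s x‖ ≤ C := by
  have step : ∀ (i m : ℕ) {f g : ℝ → ℝ → Mat n}, Smooth2 f → Smooth2 g →
      (∃ C : ℝ, ∀ s ∈ Set.Icc (-1 : ℝ) 1, ∀ x : ℝ,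
        |x| ^ p * ‖dX^[m] (dS^[i] f) s x‖ ≤ C) →
      (∃ C : ℝ, ∀ s ∈ Set.Icc (-1 : ℝ) 1, ∀ x : ℝ,
        |x| ^ p * ‖dX^[m] (dS^[i] g) s x‖ ≤ C) →
      (∃ C : ℝ, ∀ s ∈ Set.Icc (-1 : ℝ) 1, ∀ x : ℝ,
        |x| ^ p * ‖dX^[m] (dS^[i] (f + g)) s x‖ ≤ C) := by
    rintro i m f g hf hg ⟨C, hC⟩ ⟨D, hD⟩
    refine ⟨C + D, fun s hs x => ?_⟩
    rw [hf.iter_add hg]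
    calc _ ≤ |x| ^ p * (‖dX^[m] (dS^[i] f) s x‖ + ‖dX^[m] (dS^[i] g) s x‖) := by
          gcongr; exact norm_add_le _ _
      _ ≤ _ := by rw [mul_add]; exact add_le_add (hC s hs x) (hD s hs x)
  induction i with
  | zero =>
    induction m with
    | zero =>
      rintro f g hf hg ⟨q, hq, r, hr, rfl⟩
      obtain ⟨C, hC⟩ := hf.bound 0 0 q hq
      obtain ⟨D, hD⟩ := hg.bound 0 0 r hr
      refine ⟨C * D, fun s hs x => ?_⟩
      simp only [Function.iterate_zero, id_eq] at *
      calc |x| ^ (q + r) * ‖(f * g) s x‖ ≤ |x| ^ (q + r) * (‖f s x‖ * ‖g s x‖) := by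
            gcongr; exact norm_mul_le _ _
        _ = (|x| ^ q * ‖f s x‖) * (|x| ^ r * ‖g s x‖) := by ring
        _ ≤ C * D := by
            gcongr
            · exact le_trans (by positivity) (hC s hs x)
            · exact hC s hs x
            · exact hD s hs x
    | succ m ih =>
      intro f g hf hg h
      simp only [Function.iterate_succ_apply, Function.iterate_zero, id_eq] at *
      rw [hf.smooth.dX_mul hg.smooth]
      exact step 0 m (hf.dX.smooth.mul hg.smooth) (hf.smooth.mul hg.dX.smooth)
        (ih hf.dX hg h) (ih hf hg.dX h)
  | succ i ih =>
    intro f g hf hg h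
    rw [Function.iterate_succ_apply, hf.smooth.dS_mul hg.smooth]
    exact step i m (hf.dS.smooth.mul hg.smooth) (hf.smooth.mul hg.dS.smooth)
      (ih hf.dS hg h) (ih hf hg.dS h)

lemma mul (hf : Decays P f) (hg : Tame g) : Decays P (f * g) :=
  ⟨hf.smooth.mul hg.smooth, fun i m p hp =>
    mul_aux {0} p i m hf hg ⟨p, hp, 0, rfl, rfl⟩⟩

lemma mul_left (hf : Tame f) (hg : Decays P g) : Decays P (f * g) :=
  ⟨hf.smooth.mul hg.smooth, fun i m p hp =>
    mul_aux P p i m hf hg ⟨0, rfl, p, hp, zero_add p⟩⟩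

/-- Adding the bounds with weights `1` and `x²` gives the integrable majorant used in all the
integrals below. -/
lemma exists_le (hf : Rapid f) : ∃ C : ℝ, 0 ≤ C ∧ ∀ s ∈ Set.Icc (-1 : ℝ) 1, ∀ x : ℝ,
    ‖f s x‖ ≤ C * (1 + x ^ 2)⁻¹ := by
  obtain ⟨C, hC⟩ := hf.bound 0 0 0 trivial
  obtain ⟨D, hD⟩ := hf.bound 0 0 2 trivial
  simp only [Function.iterate_zero, id_eq, pow_zero, one_mul, sq_abs] at hC hD
  have key : ∀ s ∈ Set.Icc (-1 : ℝ) 1, ∀ x : ℝ, ‖f s x‖ ≤ (C + D) * (1 + x ^ 2)⁻¹ := by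
    intro s hs x
    rw [← div_eq_mul_inv, le_div_iff₀ (by positivity)]
    linarith [hC s hs x, hD s hs x]
  refine ⟨C + D, ?_, key⟩
  have := (norm_nonneg _).trans (key 0 (by simp) 0)
  simpa using this

lemma continuous_right (hf : Decays P f) (s : ℝ) : Continuous (f s) :=
  (hf.smooth.contDiff_right s).continuous

lemma integrable (hf : Rapid f) {s : ℝ} (hs : s ∈ Set.Icc (-1 : ℝ) 1) :
    MeasureTheory.Integrable (f s) := by
  obtain ⟨C, -, hC⟩ := hf.exists_le
  exact (integrable_inv_one_add_sq.const_mul C).mono' (hf.continuous_right s).aestronglyMeasurable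
    (Filter.Eventually.of_forall (hC s hs))

lemma tendsto_zero (hf : Rapid f) {s : ℝ} (hs : s ∈ Set.Icc (-1 : ℝ) 1) {l : Filter ℝ}
    (hl : Filter.Tendsto (fun x : ℝ => x ^ 2) l Filter.atTop) :
    Filter.Tendsto (f s) l (𝓝 0) := by
  obtain ⟨C, -, hC⟩ := hf.exists_le
  refine squeeze_zero_norm (hC s hs) ?_
  have : Filter.Tendsto (fun x : ℝ => (1 + x ^ 2)⁻¹) l (𝓝 0) :=
    (Filter.tendsto_atTop_add_const_left l 1 hl).inv_tendsto_atTop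
  simpa using this.const_mul C

lemma tendsto_atTop (hf : Rapid f) {s : ℝ} (hs : s ∈ Set.Icc (-1 : ℝ) 1) :
    Filter.Tendsto (f s) Filter.atTop (𝓝 0) :=
  hf.tendsto_zero hs (Filter.tendsto_pow_atTop (by norm_num))

lemma tendsto_atBot (hf : Rapid f) {s : ℝ} (hs : s ∈ Set.Icc (-1 : ℝ) 1) :
    Filter.Tendsto (f s) Filter.atBot (𝓝 0) :=
  hf.tendsto_zero hs (Filter.Tendsto.congr (fun x => by simp)
    ((Filter.tendsto_pow_atTop (α := ℝ) (n := 2) (by norm_num)).comp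
      Filter.tendsto_neg_atBot_atTop))

lemma integral_dX (hf : Rapid f) {s : ℝ} (hs : s ∈ Set.Icc (-1 : ℝ) 1) :
    ∫ x, dX f s x = 0 := by
  simpa using MeasureTheory.integral_of_hasDerivAt_of_tendsto
    (fun x => hf.smooth.hasDerivAt_dX s x) (hf.dX.integrable hs) (hf.tendsto_atBot hs)
    (hf.tendsto_atTop hs)

end Decays

/-! ### Schwartz maps and rapid decay -/

/-- A smooth map all of whose derivatives decay rapidly is a Schwartz map. -/
lemma isSchwartz_of_bound {n : ℕ} {f : ℝ → Mat n} (hf : ContDiff ℝ ∞ f)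
    (h : ∀ p m : ℕ, ∃ C : ℝ, ∀ x, |x| ^ p * ‖deriv^[m] f x‖ ≤ C) : IsSchwartz f :=
  ⟨⟨f, hf, fun p m => by
    obtain ⟨C, hC⟩ := h p m
    refine ⟨C, fun x => ?_⟩
    rw [norm_iteratedFDeriv_eq_norm_iteratedDeriv, iteratedDeriv_eq_iterate]
    exact hC x⟩, fun _ => rfl⟩

lemma IsSchwartz.bound {n : ℕ} {f : ℝ → Mat n} (h : IsSchwartz f) (p m : ℕ) :
    ∃ C : ℝ, ∀ x, |x| ^ p * ‖deriv^[m] f x‖ ≤ C := by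
  obtain ⟨φ, hφ⟩ := h
  obtain rfl : (φ : ℝ → Mat n) = f := funext hφ
  obtain ⟨C, hC⟩ := φ.decay' p m
  refine ⟨C, fun x => ?_⟩
  have := hC x
  rwa [norm_iteratedFDeriv_eq_norm_iteratedDeriv, iteratedDeriv_eq_iterate] at this

lemma iterate_dX_apply {n : ℕ} (m : ℕ) (f : ℝ → ℝ → Mat n) (s : ℝ) :
    dX^[m] f s = deriv^[m] (f s) := by
  induction m with
  | zero => rfl
  | succ m ih => rw [Function.iterate_succ_apply', Function.iterate_succ_apply', ← ih]; rfl

lemma iterate_dS_apply {n : ℕ} (i : ℕ) (f : ℝ → ℝ → Mat n) (s x : ℝ) :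
    dS^[i] f s x = deriv^[i] (fun r => f r x) s := by
  induction i generalizing s with
  | zero => rfl
  | succ i ih =>
    rw [Function.iterate_succ_apply', Function.iterate_succ_apply',
      ← (funext ih : (fun s => dS^[i] f s x) = _)]
    rfl

lemma Decays.isSchwartz {n : ℕ} {f : ℝ → ℝ → Mat n} (hf : Rapid f) {s : ℝ}
    (hs : s ∈ Set.Icc (-1 : ℝ) 1) : IsSchwartz (f s) :=
  isSchwartz_of_bound (hf.smooth.contDiff_right s) fun p m => by
    obtain ⟨C, hC⟩ := hf.bound 0 m p trivial
    exact ⟨C, fun x => by simpa [iterate_dX_apply] using hC s hs x⟩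

/-! ### Variations as two-variable functions -/

namespace IsVariation

variable {n k : ℕ} {γ : ℝ → Mat n} {Γ : ℝ → ℝ → Mat n}

lemma rapid_dX (h : IsVariation n k γ Γ) : Rapid (dX Γ) := by
  have hs : Smooth2 Γ := h.smooth
  refine ⟨hs.dX, fun i m p _ => ?_⟩
  obtain ⟨C, hC⟩ := h.bound i m p
  refine ⟨C, fun s hs' x => ?_⟩
  have := hC s hs' x
  rw [hs.iter_dS_dX, ← Function.iterate_succ_apply, iterate_dX_apply]
  rw [iteratedDeriv_eq_iterate] at this
  convert this using 5
  funext y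
  rw [iterate_dS_apply, iteratedDeriv_eq_iterate]

/-- The definition bounds only `x`-derivatives of `Γ`. A pure `s`-derivative is bounded by its value
at `x = 0`, controlled by compactness of `[-1, 1]`, plus the integral of its rapidly decaying
`x`-derivative. -/
lemma tame (h : IsVariation n k γ Γ) : Tame Γ := by
  have hs : Smooth2 Γ := h.smooth
  refine ⟨hs, fun i m p hp => ?_⟩
  obtain rfl : p = 0 := hp
  cases m with
  | succ m =>
    obtain ⟨C, hC⟩ := h.rapid_dX.bound i m 0 trivial
    refine ⟨C, fun s hs' x => ?_⟩
    rw [Function.iterate_succ_apply, ← hs.iter_dS_dX]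
    exact hC s hs' x
  | zero =>
    have hF := hs.iter_dS i
    have hR : Rapid (dX (dS^[i] Γ)) := by
      rw [← hs.iter_dS_dX]
      clear hF
      induction i with
      | zero => exact h.rapid_dX
      | succ i ih => rw [Function.iterate_succ_apply']; exact ih.dS
    obtain ⟨C, hC0, hC⟩ := hR.exists_le
    obtain ⟨D, hD⟩ := (isCompact_Icc (a := (-1 : ℝ)) (b := 1)).exists_bound_of_continuousOn
      (f := fun s => dS^[i] Γ s 0)
      (ContDiff.comp (f := fun s : ℝ => (s, (0 : ℝ))) hF (by fun_prop)).continuous.continuousOn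
    refine ⟨D + ∫ x : ℝ, C * (1 + x ^ 2)⁻¹, fun s hs' x => ?_⟩
    have hint := hR.integrable hs'
    have e : ∫ y in (0 : ℝ)..x, dX (dS^[i] Γ) s y = dS^[i] Γ s x - dS^[i] Γ s 0 :=
      intervalIntegral.integral_eq_sub_of_hasDerivAt (fun y _ => hF.hasDerivAt_dX s y)
        hint.intervalIntegrable
    have e2 : ‖∫ y in (0 : ℝ)..x, dX (dS^[i] Γ) s y‖ ≤ ∫ x : ℝ, C * (1 + x ^ 2)⁻¹ :=
      calc _ ≤ ∫ y in Set.uIoc 0 x, ‖dX (dS^[i] Γ) s y‖ :=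
            intervalIntegral.norm_integral_le_integral_norm_uIoc
        _ ≤ ∫ y, ‖dX (dS^[i] Γ) s y‖ := MeasureTheory.setIntegral_le_integral hint.norm
            (Filter.Eventually.of_forall fun _ => norm_nonneg _)
        _ ≤ _ := MeasureTheory.integral_mono hint.norm (integrable_inv_one_add_sq.const_mul C)
            (hC s hs')
    simp only [pow_zero, one_mul, Function.iterate_zero, id_eq]
    calc ‖dS^[i] Γ s x‖ = ‖dS^[i] Γ s 0 + (dS^[i] Γ s x - dS^[i] Γ s 0)‖ := by
          rw [add_sub_cancel]
      _ ≤ _ := (norm_add_le _ _).trans (add_le_add (hD s hs') (e ▸ e2))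

end IsVariation

lemma isVariation_const {n k : ℕ} {γ : ℝ → Mat n} (h : γ ∈ PathSpace n k) :
    IsVariation n k γ fun _ => γ where
  smooth := Smooth2.of_right h.1
  mem _ := h
  zero := rfl
  bound i m p := by
    cases i with
    | zero =>
      obtain ⟨C, hC⟩ := IsSchwartz.bound h.2.2.2 p m
      refine ⟨C, fun s _ x => ?_⟩
      rw [iteratedDeriv_eq_iterate, Function.iterate_succ_apply]
      simpa using hC x
    | succ i =>
      refine ⟨0, fun s _ x => ?_⟩
      simp [iteratedDeriv_const]

/-! ### The sequence `g Q_j g⁻¹` along a path -/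

section Algebra

variable {R : Type*} [Ring R] [Algebra ℝ R] {g y S : R}

lemma sq_mul_of_sq (hg : g * g = -((1 / 4 : ℝ) • 1)) (y : R) :
    g * (g * y) = -((1 / 4 : ℝ) • y) := by
  rw [← mul_assoc, hg]; simp

lemma mul_sq_of_sq (hg : g * g = -((1 / 4 : ℝ) • 1)) (y : R) :
    y * g * g = -((1 / 4 : ℝ) • y) := by
  rw [mul_assoc, hg]; simp

/-- If the sum of an element commuting with `g` and of one anticommuting with `g` vanishes, both
vanish. -/
lemma eq_zero_of_commute_of_anticommute (hg : g * g = -((1 / 4 : ℝ) • 1)) {A B : R}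
    (hA : g * A = A * g) (hB : g * B = -(B * g)) (h : A + B = 0) : A = 0 ∧ B = 0 := by
  obtain rfl : B = -A := (neg_eq_of_add_eq_zero_right h).symm
  have h1 : g * A = 0 := by
    have h2 : g * A = -(g * A) := by
      have := hB
      rw [mul_neg, neg_mul, neg_neg, ← hA] at this
      exact this.symm
    have h3 : (2 : ℝ) • (g * A) = 0 := by rw [two_smul]; nth_rewrite 1 [h2]; simp
    simpa using h3
  have h4 := sq_mul_of_sq hg A
  rw [h1, mul_zero] at h4
  have : A = 0 := by simpa using h4
  simp [this]

/-- The anticommutator with `g` commutes with `g` and the commutator anticommutes with it, because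
`g²` is a scalar; so a vanishing sum splits. -/
lemma anticommute_and_commute (hg : g * g = -((1 / 4 : ℝ) • 1))
    (h : g * y + y * g + (S * g - g * S) = 0) : g * y = -(y * g) ∧ S * g = g * S := by
  have := eq_zero_of_commute_of_anticommute hg (A := g * y + y * g) (B := S * g - g * S)
    (by simp only [mul_add, add_mul, sq_mul_of_sq hg, mul_sq_of_sq hg, mul_assoc]; rw [add_comm])
    (by simp only [mul_sub, sub_mul, sq_mul_of_sq hg, mul_sq_of_sq hg, mul_assoc]; abel) h
  exact ⟨eq_neg_of_add_eq_zero_left this.1, sub_eq_zero.1 this.2⟩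

end Algebra

/-- The sequence `q_j = g Q_j g⁻¹` along the path `γ`, where `g` is the frame of `γ`: the solution
with `q_0 = γ`, `∑_{i+l=j} q_i q_l = 0` for `j ≥ 1`, of `(q_j)_x = [q_{j+1}, γ]`. -/
def qs {n : ℕ} (γ : ℝ → Mat n) : ℕ → ℝ → Mat n
  | 0 => γ
  | j + 1 => fun x => (2 : ℝ) • (γ x * (deriv (qs γ j) x +
      ∑ i : Fin j, qs γ (i + 1) x * qs γ (j - i) x))
  decreasing_by all_goals omega

lemma qs_zero {n : ℕ} (γ : ℝ → Mat n) : qs γ 0 = γ := by rw [qs]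

/-- Origin of the formula: with `S` the sum, the two relations wanted are `q_{j+1}γ - γq_{j+1} =
(q_j)_x` and `q_{j+1}γ + γq_{j+1} = -S`. Subtracting gives `2γq_{j+1} = -((q_j)_x + S)`, and `γ⁻¹ =
-4γ`. -/
lemma qs_succ {n : ℕ} (γ : ℝ → Mat n) (j : ℕ) (x : ℝ) :
    qs γ (j + 1) x = (2 : ℝ) • (γ x * (deriv (qs γ j) x +
      ∑ i ∈ Finset.range j, qs γ (i + 1) x * qs γ (j - i) x)) := by
  rw [qs, Finset.sum_range]

lemma smooth2_qs {n : ℕ} {Γ : ℝ → ℝ → Mat n} (h : Smooth2 Γ) (j : ℕ) :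
    Smooth2 fun s => qs (Γ s) j := by
  induction j using Nat.strong_induction_on with
  | _ j ih =>
    cases j with
    | zero => simpa only [qs_zero] using h
    | succ j =>
      have e : (fun s => qs (Γ s) (j + 1)) = (2 : ℝ) • (Γ * (dX (fun s => qs (Γ s) j) +
          ∑ i ∈ Finset.range j, (fun s => qs (Γ s) (i + 1)) * fun s => qs (Γ s) (j - i))) := by
        funext s x
        rw [qs_succ]
        simp [dX, Finset.sum_apply]
      rw [e]
      refine (h.mul ((ih j (by omega)).dX.add ?_)).const_smul 2
      refine Finset.sum_induction _ Smooth2 (fun _ _ => Smooth2.add) Smooth2.zero fun i hi => ?_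
      have := Finset.mem_range.1 hi
      exact (ih _ (by omega)).mul (ih _ (by omega))

lemma rapid_qs_succ {n : ℕ} {Γ : ℝ → ℝ → Mat n} (h : Tame Γ) (h' : Rapid (dX Γ)) (j : ℕ) :
    Rapid fun s => qs (Γ s) (j + 1) := by
  induction j using Nat.strong_induction_on with
  | _ j ih =>
    have e : (fun s => qs (Γ s) (j + 1)) = (2 : ℝ) • (Γ * (dX (fun s => qs (Γ s) j) +
        ∑ i ∈ Finset.range j, (fun s => qs (Γ s) (i + 1)) * fun s => qs (Γ s) (j - i))) := by
      funext s x
      rw [qs_succ]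
      simp [dX, Finset.sum_apply]
    rw [e]
    refine (h.mul_left (Decays.add ?_ ?_)).const_smul 2
    · cases j with
      | zero => simpa only [qs_zero] using h'
      | succ j => exact (ih j (by omega)).dX
    · refine Decays.sum fun i hi => ?_
      have := Finset.mem_range.1 hi
      -- The sum never contains `q_0 = γ`, the one member of the sequence that does not decay.
      obtain ⟨l, hl⟩ : ∃ l, j - i = l + 1 := ⟨j - i - 1, by omega⟩
      rw [hl]
      exact (ih i this).mul (ih l (by omega)).tame

lemma tame_qs {n : ℕ} {Γ : ℝ → ℝ → Mat n} (h : Tame Γ) (h' : Rapid (dX Γ)) (j : ℕ) :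
    Tame fun s => qs (Γ s) j := by
  cases j with
  | zero => simpa only [qs_zero] using h
  | succ j => exact (rapid_qs_succ h h' j).tame

lemma contDiff_qs {n : ℕ} {γ : ℝ → Mat n} (h : ContDiff ℝ ∞ γ) (j : ℕ) : ContDiff ℝ ∞ (qs γ j) :=
  (smooth2_qs (Smooth2.of_right h) j).contDiff_right 0

lemma hasDerivAt_qs {n : ℕ} {γ : ℝ → Mat n} (h : ContDiff ℝ ∞ γ) (j : ℕ) (x : ℝ) :
    HasDerivAt (qs γ j) (deriv (qs γ j) x) x :=
  ((contDiff_qs h j).differentiable (by simp) x).hasDerivAt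

section Relations

variable {n : ℕ} {γ : ℝ → Mat n} (hγ : ContDiff ℝ ∞ γ)
  (hsq : ∀ x, γ x * γ x = -((1 / 4 : ℝ) • (1 : Mat n)))

include hγ hsq

/-- The differential and the quadratic relations must be proved together. The quadratic relation at
level `j`, differentiated, gives the third clause; that clause is exactly what makes the recursive
formula for `q_{j+1}` satisfy both relations at the next level. -/
lemma qs_relations (j : ℕ) :
    (∀ i < j, ∀ x, deriv (qs γ i) x = qs γ (i + 1) x * γ x - γ x * qs γ (i + 1) x) ∧
    (∀ m, 1 ≤ m → m ≤ j → ∀ x, ∑ i ∈ Finset.range (m + 1), qs γ i x * qs γ (m - i) x = 0) ∧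
    ∀ x, γ x * deriv (qs γ j) x = -(deriv (qs γ j) x * γ x) ∧
      (∑ i ∈ Finset.range j, qs γ (i + 1) x * qs γ (j - i) x) * γ x =
        γ x * ∑ i ∈ Finset.range j, qs γ (i + 1) x * qs γ (j - i) x := by
  have hd := hasDerivAt_qs hγ
  -- differentiate the quadratic relation
  have last : ∀ j, (∀ i < j, ∀ x, deriv (qs γ i) x =
        qs γ (i + 1) x * γ x - γ x * qs γ (i + 1) x) →
      (∃ c, ∀ x, ∑ i ∈ Finset.range (j + 1), qs γ i x * qs γ (j - i) x = c) →
      ∀ x, γ x * deriv (qs γ j) x = -(deriv (qs γ j) x * γ x) ∧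
        (∑ i ∈ Finset.range j, qs γ (i + 1) x * qs γ (j - i) x) * γ x =
          γ x * ∑ i ∈ Finset.range j, qs γ (i + 1) x * qs γ (j - i) x := by
    rintro j h1 ⟨c, hc⟩ x
    refine anticommute_and_commute (hsq x) ?_
    have h3 : ∑ i ∈ Finset.range (j + 1), (deriv (qs γ i) x * qs γ (j - i) x +
        qs γ i x * deriv (qs γ (j - i)) x) = 0 := by
      have h4 : HasDerivAt (fun x => ∑ i ∈ Finset.range (j + 1), qs γ i x * qs γ (j - i) x)
          (∑ i ∈ Finset.range (j + 1), (deriv (qs γ i) x * qs γ (j - i) x +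
            qs γ i x * deriv (qs γ (j - i)) x)) x :=
        HasDerivAt.fun_sum fun i _ => (hd i x).mul (hd (j - i) x)
      rw [funext hc] at h4
      exact h4.unique (hasDerivAt_const x c)
    -- The terms containing `(q_j)_x` are isolated and form its anticommutator with `γ`; after
    -- substitution of the differential relation the others add up to the commutator of the
    -- quadratic sum with `γ`.
    rw [Finset.sum_add_distrib, Finset.sum_range_succ, Finset.sum_range_succ'] at h3
    rw [← h3]
    have e0 : ∑ i ∈ Finset.range j, deriv (qs γ i) x * qs γ (j - i) x = ∑ i ∈ Finset.range j,
        (qs γ (i + 1) x * γ x - γ x * qs γ (i + 1) x) * qs γ (j - i) x :=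
      Finset.sum_congr rfl fun i hi => by rw [h1 i (Finset.mem_range.1 hi) x]
    have e : ∑ i ∈ Finset.range j, qs γ (i + 1) x * deriv (qs γ (j - (i + 1))) x =
        ∑ i ∈ Finset.range j, qs γ (i + 1) x * (qs γ (j - i) x * γ x - γ x * qs γ (j - i) x) := by
      refine Finset.sum_congr rfl fun i hi => ?_
      have := Finset.mem_range.1 hi
      rw [h1 (j - (i + 1)) (by omega) x, show j - (i + 1) + 1 = j - i by omega]
    rw [e0, e, Finset.sum_mul, Finset.mul_sum]
    have e2 : ∑ i ∈ Finset.range j, qs γ (i + 1) x * qs γ (j - i) x * γ x -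
        ∑ i ∈ Finset.range j, γ x * (qs γ (i + 1) x * qs γ (j - i) x) =
        ∑ i ∈ Finset.range j, (qs γ (i + 1) x * γ x - γ x * qs γ (i + 1) x) * qs γ (j - i) x +
        ∑ i ∈ Finset.range j, qs γ (i + 1) x * (qs γ (j - i) x * γ x - γ x * qs γ (j - i) x) := by
      rw [← Finset.sum_sub_distrib, ← Finset.sum_add_distrib]
      exact Finset.sum_congr rfl fun i _ => by noncomm_ring
    rw [e2]
    simp only [Nat.sub_self, Nat.sub_zero, qs_zero]
    abel
  induction j with
  | zero =>
    -- At level `0` the quadratic sum is `γ² = -1/4`, not `0`; only its constancy is needed.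
    refine ⟨by simp, by omega, last 0 (by simp) ⟨-((1 / 4 : ℝ) • 1), fun x => ?_⟩⟩
    simpa [qs_zero] using hsq x
  | succ j ih =>
    obtain ⟨h1, h2, h3⟩ := ih
    have h1' : ∀ i < j + 1, ∀ x, deriv (qs γ i) x =
        qs γ (i + 1) x * γ x - γ x * qs γ (i + 1) x := by
      intro i hi x
      rcases Nat.lt_succ_iff_lt_or_eq.1 hi with h | rfl
      · exact h1 i h x
      · obtain ⟨ha, hc⟩ := h3 x
        rw [qs_succ]
        set y := deriv (qs γ i) x
        set S := ∑ l ∈ Finset.range i, qs γ (l + 1) x * qs γ (i - l) x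
        have ha' : y * γ x = -(γ x * y) := by rw [ha, neg_neg]
        simp only [mul_add, smul_add, add_mul, smul_mul_assoc, mul_smul_comm, mul_assoc, hc, ha',
          mul_neg, sq_mul_of_sq (hsq x)]
        module
    have h2' : ∀ m, 1 ≤ m → m ≤ j + 1 → ∀ x,
        ∑ i ∈ Finset.range (m + 1), qs γ i x * qs γ (m - i) x = 0 := by
      intro m hm hmj x
      rcases Nat.le_succ_iff.1 hmj with h | rfl
      · exact h2 m hm h x
      · obtain ⟨ha, hc⟩ := h3 x
        rw [Finset.sum_range_succ, Finset.sum_range_succ']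
        simp only [Nat.sub_self, Nat.sub_zero, qs_zero, Nat.succ_eq_add_one, Nat.add_sub_add_right]
        rw [qs_succ]
        set y := deriv (qs γ j) x
        set S := ∑ l ∈ Finset.range j, qs γ (l + 1) x * qs γ (j - l) x
        have ha' : y * γ x = -(γ x * y) := by rw [ha, neg_neg]
        simp only [mul_add, smul_add, add_mul, smul_mul_assoc, mul_smul_comm, mul_assoc, hc, ha',
          mul_neg, sq_mul_of_sq (hsq x)]
        module
    exact ⟨h1', h2', last (j + 1) h1' ⟨0, h2' (j + 1) (by omega) le_rfl⟩⟩

lemma deriv_qs (j : ℕ) (x : ℝ) : deriv (qs γ j) x = ⁅qs γ (j + 1) x, γ x⁆ :=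
  (qs_relations hγ hsq (j + 1)).1 j (by omega) x

lemma sum_qs_mul_qs (j : ℕ) (hj : 1 ≤ j) (x : ℝ) :
    ∑ i ∈ Finset.range (j + 1), qs γ i x * qs γ (j - i) x = 0 :=
  (qs_relations hγ hsq j).2.1 j hj le_rfl x

lemma anticommute_deriv_qs (j : ℕ) (x : ℝ) :
    γ x * deriv (qs γ j) x = -(deriv (qs γ j) x * γ x) :=
  ((qs_relations hγ hsq j).2.2 x).1

/-- The sum in the recursion is Hermitian, as taking adjoints reverses its order, and commutes with
`γ`; `(q_j)_x` is skew-Hermitian and anticommutes with `γ`. Both products with `γ` are therefore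
skew-Hermitian. -/
lemma qs_mem (hu : ∀ x, γ x ∈ u n) (j : ℕ) (x : ℝ) : qs γ j x ∈ u n := by
  induction j using Nat.strong_induction_on generalizing x with
  | _ j ih =>
    cases j with
    | zero => simpa only [qs_zero] using hu x
    | succ j =>
      have hd : deriv (qs γ j) x ∈ u n := by
        rw [skewAdjoint.mem_iff]
        have h1 := (hasDerivAt_qs hγ j x).star
        have h2 : (fun y => star (qs γ j y)) = fun y => -qs γ j y :=
          funext fun y => skewAdjoint.mem_iff.1 (ih j (by omega) y)
        rw [h2] at h1
        exact h1.unique (hasDerivAt_qs hγ j x).neg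
      obtain ⟨ha, hc⟩ := (qs_relations hγ hsq j).2.2 x
      rw [qs_succ]
      set S := ∑ i ∈ Finset.range j, qs γ (i + 1) x * qs γ (j - i) x with hS
      have hSs : star S = S := by
        rw [hS, star_sum, ← Finset.sum_range_reflect]
        refine Finset.sum_congr rfl fun i hi => ?_
        have := Finset.mem_range.1 hi
        rw [star_mul, skewAdjoint.mem_iff.1 (ih _ (by omega) x),
          skewAdjoint.mem_iff.1 (ih _ (by omega) x), neg_mul_neg]
        congr 3 <;> omega
      rw [skewAdjoint.mem_iff] at hd ⊢
      rw [star_smul, star_mul, star_add, hSs, hd, skewAdjoint.mem_iff.1 (hu x), add_mul, mul_neg,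
        mul_neg, hc, neg_mul, neg_neg, mul_add, ha]
      simp [add_comm]

end Relations

lemma gr_sq_real {n k : ℕ} {y : Mat n} (hy : y ∈ Gr n k) : y * y = -((1 / 4 : ℝ) • (1 : Mat n)) := by
  rw [gr_sq hy]
  ext i j
  simp [Matrix.smul_apply]

/-! ### A linear equation with initial condition at `-∞` -/

section Primitive

variable {n : ℕ} {F : ℝ → Mat n} {D : ℝ}

lemma integrable_of_le_inv_one_add_sq (hF : Continuous F)
    (hD : ∀ x, ‖F x‖ ≤ D * (1 + x ^ 2)⁻¹) : MeasureTheory.Integrable F :=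
  (integrable_inv_one_add_sq.const_mul D).mono' hF.aestronglyMeasurable
    (Filter.Eventually.of_forall hD)

lemma norm_integral_Iic_le (hD : ∀ x, ‖F x‖ ≤ D * (1 + x ^ 2)⁻¹) (x : ℝ) :
    ‖∫ y in Set.Iic x, F y‖ ≤ D * (Real.arctan x + Real.pi / 2) := by
  rw [← integral_Iic_inv_one_add_sq, ← MeasureTheory.integral_const_mul]
  exact MeasureTheory.norm_integral_le_of_norm_le
    (integrable_inv_one_add_sq.const_mul D).integrableOn (Filter.Eventually.of_forall hD)

lemma hasDerivAt_integral_Iic (hF : Continuous F)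
    (hD : ∀ x, ‖F x‖ ≤ D * (1 + x ^ 2)⁻¹) (x : ℝ) :
    HasDerivAt (fun x => ∫ y in Set.Iic x, F y) (F x) x := by
  have hint := integrable_of_le_inv_one_add_sq hF hD
  have e : (fun x => ∫ y in Set.Iic x, F y) =
      fun x => (∫ y in Set.Iic 0, F y) + ∫ y in (0 : ℝ)..x, F y := by
    funext x
    rw [← intervalIntegral.integral_Iic_sub_Iic hint.integrableOn hint.integrableOn]
    abel
  rw [e]
  exact (intervalIntegral.integral_hasDerivAt_right hint.intervalIntegrable
    hF.aestronglyMeasurable.stronglyMeasurableAtFilter hF.continuousAt).const_add _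

lemma tendsto_integral_Iic (hD : ∀ x, ‖F x‖ ≤ D * (1 + x ^ 2)⁻¹) :
    Filter.Tendsto (fun x => ∫ y in Set.Iic x, F y) Filter.atBot (𝓝 0) := by
  refine squeeze_zero_norm (norm_integral_Iic_le hD) ?_
  have h := (Real.tendsto_arctan_atBot.mono_right nhdsWithin_le_nhds).add_const (Real.pi / 2)
  simpa using h.const_mul D

end Primitive

/-- Picard iteration started at `-∞`. A bound by an integrable function makes the integral operator
a contraction on the whole line for a weighted sup norm. -/
lemma exists_hasDerivAt_mul_tendsto_one {n : ℕ} {B : ℝ → Mat n} (hB : Continuous B) {C : ℝ}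
    (hC : ∀ x, ‖B x‖ ≤ C * (1 + x ^ 2)⁻¹) :
    ∃ g : ℝ → Mat n, (∀ x, HasDerivAt g (B x * g x) x) ∧
      Filter.Tendsto g Filter.atBot (𝓝 1) := by
  have hC0 : 0 ≤ C := by simpa using (norm_nonneg _).trans (hC 0)
  -- a weight that makes the integral operator a contraction
  let e : ℝ → ℝ := fun x => Real.exp (2 * C * Real.arctan x)
  have he0 : ∀ x, 0 < e x := fun x => Real.exp_pos _
  have hec : Continuous e := by fun_prop
  let M : ℝ := Real.exp (C * Real.pi)
  have hM : ∀ x, e x ≤ M := fun x => by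
    refine Real.exp_le_exp.2 ?_
    nlinarith [Real.arctan_lt_pi_div_two x]
  have hM' : ∀ x, (e x)⁻¹ ≤ M := fun x => by
    rw [← Real.exp_neg]
    refine Real.exp_le_exp.2 ?_
    nlinarith [Real.neg_pi_div_two_lt_arctan x]
  have hM0 : 0 < M := Real.exp_pos _
  have hFc : ∀ h : BoundedContinuousFunction ℝ (Mat n),
      Continuous fun y => e y • (B y * h y) := fun h => hec.smul (hB.mul h.continuous)
  have hF' : ∀ (h : BoundedContinuousFunction ℝ (Mat n)) (y : ℝ), ‖e y • (B y * h y)‖ ≤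
      ‖h‖ * (e y * (C * (1 + y ^ 2)⁻¹)) := by
    intro h y
    rw [norm_smul, Real.norm_eq_abs, abs_of_pos (he0 y)]
    calc e y * ‖B y * h y‖ ≤ e y * ((C * (1 + y ^ 2)⁻¹) * ‖h‖) := by
          gcongr
          exact (norm_mul_le _ _).trans
            (mul_le_mul (hC y) (h.norm_coe_le_norm y) (norm_nonneg _) (by positivity))
      _ = _ := by ring
  have hF : ∀ (h : BoundedContinuousFunction ℝ (Mat n)) (y : ℝ), ‖e y • (B y * h y)‖ ≤
      (‖h‖ * M * C) * (1 + y ^ 2)⁻¹ := by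
    intro h y
    refine (hF' h y).trans ?_
    calc _ ≤ ‖h‖ * (M * (C * (1 + y ^ 2)⁻¹)) := by gcongr; exact hM y
      _ = _ := by ring
  -- the weight is a primitive
  have hint : MeasureTheory.Integrable fun y : ℝ => e y * (C * (1 + y ^ 2)⁻¹) := by
    refine (integrable_inv_one_add_sq.const_mul (M * C)).mono' (by
      refine Continuous.aestronglyMeasurable (hec.mul (continuous_const.mul ?_))
      exact Continuous.inv₀ (by fun_prop) fun y => by positivity)
      (Filter.Eventually.of_forall fun y => ?_)
    have := he0 y
    rw [Real.norm_eq_abs, abs_of_nonneg (by positivity), mul_assoc]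
    gcongr
    exact hM y
  -- The factor `2` in the exponent of `e` makes `e / 2` the primitive, which is where the
  -- contraction constant `1/2` comes from.
  have hweight : ∀ x, ∫ y in Set.Iic x, e y * (C * (1 + y ^ 2)⁻¹) ≤ e x / 2 := by
    intro x
    have hd : ∀ y, HasDerivAt (fun y => e y / 2) (e y * (C * (1 + y ^ 2)⁻¹)) y := by
      intro y
      have := (((Real.hasDerivAt_arctan y).const_mul (2 * C)).exp).div_const 2
      convert! this using 1
      ring
    have hl : Filter.Tendsto (fun y => e y / 2) Filter.atBot
        (𝓝 (Real.exp (2 * C * -(Real.pi / 2)) / 2)) :=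
      ((Real.continuous_exp.tendsto _).comp
        ((Real.tendsto_arctan_atBot.mono_right nhdsWithin_le_nhds).const_mul (2 * C))).div_const 2
    rw [MeasureTheory.integral_Iic_of_hasDerivAt_of_tendsto' (fun y _ => hd y) hint.integrableOn hl]
    linarith [Real.exp_pos (2 * C * -(Real.pi / 2))]
  have hIc : ∀ h : BoundedContinuousFunction ℝ (Mat n),
      Continuous fun x => ∫ y in Set.Iic x, e y • (B y * h y) := fun h =>
    continuous_iff_continuousAt.2 fun x => (hasDerivAt_integral_Iic (hFc h) (hF h) x).continuousAt
  -- The unknown is `h = e⁻¹ g`: dividing by the weight turns the weighted norm into the usual sup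
  -- norm.
  let T : BoundedContinuousFunction ℝ (Mat n) → BoundedContinuousFunction ℝ (Mat n) := fun h =>
    BoundedContinuousFunction.ofNormedAddCommGroup
      (fun x => (e x)⁻¹ • (1 + ∫ y in Set.Iic x, e y • (B y * h y)))
      ((hec.inv₀ fun x => (he0 x).ne').smul (continuous_const.add (hIc h)))
      (M * (‖(1 : Mat n)‖ + ‖h‖ * M * C * Real.pi)) (fun x => by
        rw [norm_smul, Real.norm_eq_abs, abs_of_pos (inv_pos.2 (he0 x))]
        gcongr
        · exact hM' x
        · refine (norm_add_le _ _).trans ?_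
          gcongr
          refine (norm_integral_Iic_le (hF h) x).trans ?_
          gcongr
          linarith [Real.arctan_lt_pi_div_two x])
  have hT : ContractingWith (1 / 2) T := by
    refine ⟨by norm_num, LipschitzWith.of_dist_le_mul fun h h' => ?_⟩
    rw [BoundedContinuousFunction.dist_le (by positivity)]
    intro x
    have hsub : ∀ y, e y • (B y * h y) - e y • (B y * h' y) = e y • (B y * (h - h') y) := by
      intro y
      rw [BoundedContinuousFunction.sub_apply, mul_sub, smul_sub]
    have key : T h x - T h' x = (e x)⁻¹ • ∫ y in Set.Iic x, e y • (B y * (h - h') y) := by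
      simp only [← hsub]
      rw [MeasureTheory.integral_sub
        (integrable_of_le_inv_one_add_sq (hFc h) (hF h)).integrableOn
        (integrable_of_le_inv_one_add_sq (hFc h') (hF h')).integrableOn, smul_sub]
      simp only [T, BoundedContinuousFunction.coe_ofNormedAddCommGroup, smul_add]
      abel
    rw [dist_eq_norm, key, norm_smul, Real.norm_eq_abs, abs_of_pos (inv_pos.2 (he0 x)),
      dist_eq_norm]
    have := MeasureTheory.norm_integral_le_of_norm_le (hint.const_mul ‖h - h'‖).integrableOn
      (Filter.Eventually.of_forall (hF' (h - h'))) (μ := MeasureTheory.volume.restrict (Set.Iic x))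
    rw [MeasureTheory.integral_const_mul] at this
    rw [inv_mul_le_iff₀ (he0 x)]
    calc _ ≤ ‖h - h'‖ * (e x / 2) := this.trans (by gcongr; exact hweight x)
      _ = _ := by push_cast; ring
  obtain ⟨h, hfix⟩ : ∃ h, T h = h := ⟨_, hT.fixedPoint_isFixedPt⟩
  have hg : (fun x => e x • h x) = fun x => 1 + ∫ y in Set.Iic x, e y • (B y * h y) := by
    funext x
    conv_lhs => rw [← hfix]
    simp only [T, BoundedContinuousFunction.coe_ofNormedAddCommGroup]
    rw [smul_inv_smul₀ (he0 x).ne']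
  refine ⟨fun x => e x • h x, fun x => ?_, ?_⟩
  · have := (hasDerivAt_integral_Iic (hFc h) (hF h) x).const_add 1
    rwa [← hg, ← mul_smul_comm] at this
  · rw [hg]
    simpa using (tendsto_integral_Iic (hF h)).const_add 1

/-- A map with zero derivative is constant, with value its limit at `-∞`. -/
lemma eq_of_hasDerivAt_zero_of_tendsto {n : ℕ} {f : ℝ → Mat n} {c : Mat n}
    (h : ∀ x, HasDerivAt f 0 x) (hc : Filter.Tendsto f Filter.atBot (𝓝 c)) (x : ℝ) : f x = c := by
  have h1 : f = fun _ => f x := funext fun y =>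
    is_const_of_deriv_eq_zero (fun y => (h y).differentiableAt) (fun y => (h y).deriv) y x
  rw [h1] at hc
  exact tendsto_nhds_unique tendsto_const_nhds hc

/-! ### The frame of a path and the sequence `Q_j` -/

open scoped ComplexOrder in
lemma eq_zero_of_ip_self {n : ℕ} {z : Mat n} (hz : z ∈ u n) (h : ip z z = 0) : z = 0 := by
  have hz' : z.conjTranspose = -z := skewAdjoint.mem_iff.1 hz
  have h1 : ip z z = (Matrix.trace (z.conjTranspose * z)).re := by
    rw [hz', neg_mul, Matrix.trace_neg, ip, Complex.neg_re]
  have h2 := (Matrix.posSemidef_conjTranspose_mul_self z).trace_nonneg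
  rw [← Matrix.trace_conjTranspose_mul_self_eq_zero_iff]
  exact Complex.ext (by rw [← h1, h]; rfl) (Complex.nonneg_iff.1 h2).2.symm

/-- Moving one factor `a` of `a * a * w * z` around the trace changes the sign, and `a * a` is a
nonzero scalar. -/
lemma trace_mul_eq_zero {n : ℕ} {a w z : Mat n} (ha : a * a = -((1 / 4 : ℝ) • 1))
    (hw : a * w = -(w * a)) (hz : z * a = a * z) : Matrix.trace (w * z) = 0 := by
  have h1 : Matrix.trace (a * (a * (w * z))) = -Matrix.trace (a * (a * (w * z))) := by
    calc _ = Matrix.trace (a * (a * w) * z) := by noncomm_ring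
      _ = -Matrix.trace (a * w * (a * z)) := by
        have : a * (a * w) * z = a * (-(w * a)) * z := by rw [hw]
        rw [this, ← Matrix.trace_neg]; congr 1; noncomm_ring
      _ = -Matrix.trace ((a * w * z) * a) := by rw [← hz]; congr 2; noncomm_ring
      _ = _ := by rw [Matrix.trace_mul_comm]; congr 2; noncomm_ring
  rw [sq_mul_of_sq ha, Matrix.trace_neg, Matrix.trace_smul, neg_neg] at h1
  have h2 : (1 / 2 : ℝ) • Matrix.trace (w * z) = 0 := by
    have := add_eq_zero_iff_eq_neg.2 h1.symm
    rw [← add_smul] at this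
    norm_num at this ⊢
    exact this
  simpa using h2

lemma base_sq_real (n k : ℕ) : base n k * base n k = -((1 / 4 : ℝ) • (1 : Mat n)) :=
  gr_sq_real (k := k) ⟨1, one_mem _, by simp⟩

lemma centPerp_anticommute {n k : ℕ} {w : Mat n} (hw : w ∈ centPerp n k) :
    base n k * w = -(w * base n k) := by
  set a := base n k with ha
  have hsq : a * a = -((1 / 4 : ℝ) • (1 : Mat n)) := base_sq_real n k
  have hau : star a = -a := skewAdjoint.mem_iff.1 (base_mem n k)
  have hwu : star w = -w := skewAdjoint.mem_iff.1 hw.1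
  -- `z` is twice the part of `w` commuting with `a`. It is an admissible test element, and `⟨z, z⟩
  -- = 2⟨w, z⟩ = 0` forces it to vanish.
  set z := w - (4 : ℝ) • (a * w * a) with hz
  have hzu : z ∈ u n := by
    rw [skewAdjoint.mem_iff, hz, star_sub, star_smul, star_mul, star_mul, hau, hwu]
    simp only [star_trivial, neg_mul, mul_neg, neg_neg, smul_neg, mul_assoc]
    abel
  have hcomm : z * a = a * z := by
    simp only [hz, sub_mul, mul_sub, smul_mul_assoc, mul_smul_comm, mul_assoc, hsq,
      sq_mul_of_sq hsq, mul_neg, mul_one]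
    module
  have h0 : ip w z = 0 := hw.2 z hzu (by rw [Ring.lie_def, hcomm, sub_self])
  have h1 : ip z z = 2 * ip w z := by
    have e : Matrix.trace (a * w * a * z) = -((1 / 4 : ℝ) • Matrix.trace (w * z)) := by
      rw [mul_assoc, ← hcomm, mul_assoc, Matrix.trace_mul_comm,
        show w * (z * a) * a = w * z * a * a by noncomm_ring, mul_sq_of_sq hsq, Matrix.trace_neg,
        Matrix.trace_smul]
    have e2 : z * z = w * z - (4 : ℝ) • (a * w * a * z) := by
      nth_rewrite 1 [hz]
      rw [sub_mul, smul_mul_assoc]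
    rw [ip, ip, e2, Matrix.trace_sub, Matrix.trace_smul, e]
    simp only [Complex.sub_re, Complex.real_smul, Complex.mul_re, Complex.neg_re, Complex.neg_im,
      Complex.ofReal_re, Complex.ofReal_im]
    ring
  have h2 : z = 0 := eq_zero_of_ip_self hzu (by rw [h1, h0, mul_zero])
  have h3 : w = (4 : ℝ) • (a * w * a) := sub_eq_zero.1 h2
  calc a * w = a * ((4 : ℝ) • (a * w * a)) := by rw [← h3]
    _ = -(w * a) := by
      rw [mul_smul_comm, mul_assoc, sq_mul_of_sq hsq, smul_neg, smul_smul]; norm_num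

section Unitary

variable {n : ℕ} {g : Mat n} (hg : g ∈ Matrix.unitaryGroup (Fin n) ℂ)

include hg

lemma inv_eq_star : g⁻¹ = star g := Matrix.inv_eq_left_inv ((Matrix.mem_unitaryGroup_iff').1 hg)

lemma inv_mul_unitary : g⁻¹ * g = 1 := by
  rw [inv_eq_star hg]; exact (Matrix.mem_unitaryGroup_iff').1 hg

lemma mul_inv_unitary : g * g⁻¹ = 1 := by
  rw [inv_eq_star hg]; exact (Matrix.mem_unitaryGroup_iff).1 hg

lemma inv_mul_cancel_unitary (y : Mat n) : g⁻¹ * (g * y) = y := by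
  rw [← mul_assoc, inv_mul_unitary hg, one_mul]

lemma mul_inv_cancel_unitary (y : Mat n) : g * (g⁻¹ * y) = y := by
  rw [← mul_assoc, mul_inv_unitary hg, one_mul]

lemma norm_conj_unitary (A : Mat n) : ‖g⁻¹ * A * g‖ = ‖A‖ := by
  rw [CStarRing.norm_mul_mem_unitary _ hg, inv_eq_star hg,
    CStarRing.norm_mem_unitary_mul _ (Unitary.star_mem hg)]

end Unitary

/-- A frame solves `g_x = [γ, γ_x] g`. -/
lemma IsFrame.hasDerivAt {n k : ℕ} {γ g : ℝ → Mat n} (hg : IsFrame n k γ g) (x : ℝ) :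
    HasDerivAt g (qs γ 1 x * g x) x := by
  have hd : HasDerivAt g (deriv g x) x := (hg.smooth.differentiable (by simp) x).hasDerivAt
  set w := (g x)⁻¹ * deriv g x with hw
  have hgw : deriv g x = g x * w := by rw [hw, mul_inv_cancel_unitary (hg.unitary x)]
  have ha := centPerp_anticommute (hg.perp x)
  rw [← hw] at ha
  set a := base n k with haa
  have hsq : a * a = -((1 / 4 : ℝ) • (1 : Mat n)) := base_sq_real n k
  have hwu : star w = -w := skewAdjoint.mem_iff.1 (hg.perp x).1
  have hγ : γ = fun x => g x * a * star (g x) :=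
    funext fun y => by rw [hg.conj y, inv_eq_star (hg.unitary y)]
  have hd2 : HasDerivAt γ (g x * (w * a - a * w) * star (g x)) x := by
    have h1 := (hd.mul_const a).mul hd.star
    rw [hγ]
    convert! h1 using 1
    rw [hgw, star_mul, hwu]
    noncomm_ring
  have h3 : star (g x) * g x = 1 := (Matrix.mem_unitaryGroup_iff').1 (hg.unitary x)
  -- Here `γ_x = g [w, a] g⁻¹`, and `2a[w, a] = w` because `w` anticommutes with `a`; so `q_1 =
  -- 2γγ_x` is `g w g⁻¹`.
  have h4 : qs γ 1 x * g x = g x * w := by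
    rw [qs_succ]
    simp only [Finset.range_zero, Finset.sum_empty, add_zero, qs_zero]
    rw [hd2.deriv, hγ]
    have h5 : a * (w * a - a * w) = (1 / 2 : ℝ) • w := by
      have : w * a = -(a * w) := by rw [ha, neg_neg]
      rw [this, mul_sub, mul_neg, sq_mul_of_sq hsq]
      module
    calc (2 : ℝ) • (g x * a * star (g x) * (g x * (w * a - a * w) * star (g x))) * g x
        = (2 : ℝ) • (g x * a * (star (g x) * g x) * (w * a - a * w) * (star (g x) * g x)) := by
          rw [smul_mul_assoc]; congr 1; simp only [mul_assoc]
      _ = (2 : ℝ) • (g x * (a * (w * a - a * w))) := by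
          rw [h3]; simp only [mul_one, mul_assoc]
      _ = g x * w := by rw [h5, mul_smul_comm, smul_smul]; norm_num
  rwa [h4, ← hgw]

namespace PathSpace

variable {n k : ℕ} {γ : ℝ → Mat n} (h : γ ∈ PathSpace n k)

include h

lemma contDiff : ContDiff ℝ ∞ γ := h.1

lemma sq (x : ℝ) : γ x * γ x = -((1 / 4 : ℝ) • (1 : Mat n)) := gr_sq_real (h.2.1 x)

lemma mem_u (x : ℝ) : γ x ∈ u n := gr_mem (h.2.1 x)

lemma tame : Tame fun _ => γ := (isVariation_const h).tame

lemma tame_qs (j : ℕ) : Tame fun _ => qs γ j :=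
  GrassmannFlow.tame_qs (isVariation_const h).tame (isVariation_const h).rapid_dX j

lemma rapid_qs (j : ℕ) : Rapid fun _ => qs γ (j + 1) :=
  rapid_qs_succ (isVariation_const h).tame (isVariation_const h).rapid_dX j

lemma hasDerivAt_qs (j : ℕ) (x : ℝ) :
    HasDerivAt (qs γ j) (qs γ (j + 1) x * γ x - γ x * qs γ (j + 1) x) x := by
  have := GrassmannFlow.hasDerivAt_qs (PathSpace.contDiff h) j x
  rwa [deriv_qs (PathSpace.contDiff h) (PathSpace.sq h), Ring.lie_def] at this

lemma hasDerivAt_self (x : ℝ) : HasDerivAt γ (qs γ 1 x * γ x - γ x * qs γ 1 x) x := by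
  simpa only [qs_zero] using PathSpace.hasDerivAt_qs h 0 x

lemma qs_one_anticommute (x : ℝ) : γ x * qs γ 1 x = -(qs γ 1 x * γ x) := by
  have := sum_qs_mul_qs (PathSpace.contDiff h) (PathSpace.sq h) 1 le_rfl x
  simp only [Finset.sum_range_succ, Finset.sum_range_zero, qs_zero, zero_add, Nat.sub_zero,
    Nat.sub_self] at this
  exact eq_neg_of_add_eq_zero_left this

lemma qs_mem (j : ℕ) (x : ℝ) : qs γ j x ∈ u n :=
  GrassmannFlow.qs_mem (PathSpace.contDiff h) (PathSpace.sq h) (PathSpace.mem_u h) j x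

lemma hasDerivAt_conj {g A : ℝ → Mat n} {A' : Mat n} (hg : ∀ x, HasDerivAt g (qs γ 1 x * g x) x)
    {x : ℝ} (hA : HasDerivAt A A' x) :
    HasDerivAt (fun x => star (g x) * A x * g x)
      (star (g x) * (A' + A x * qs γ 1 x - qs γ 1 x * A x) * g x) x := by
  convert! ((hg x).star.mul hA).mul (hg x) using 1
  simp only [Pi.mul_apply]
  rw [star_mul, skewAdjoint.mem_iff.1 (PathSpace.qs_mem h 1 x)]
  noncomm_ring

/-- The product is constant because `q_1` is skew-Hermitian. With `g₁ = g₂` this is unitarity; with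
two solutions it is uniqueness of the frame. -/
lemma star_mul_eq_one {g₁ g₂ : ℝ → Mat n} (h₁ : ∀ x, HasDerivAt g₁ (qs γ 1 x * g₁ x) x)
    (h₂ : ∀ x, HasDerivAt g₂ (qs γ 1 x * g₂ x) x) (l₁ : Filter.Tendsto g₁ Filter.atBot (𝓝 1))
    (l₂ : Filter.Tendsto g₂ Filter.atBot (𝓝 1)) (x : ℝ) : star (g₁ x) * g₂ x = 1 := by
  refine eq_of_hasDerivAt_zero_of_tendsto (f := fun x => star (g₁ x) * g₂ x) (fun x => ?_) ?_ x
  · convert! (h₁ x).star.mul (h₂ x) using 1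
    rw [star_mul, skewAdjoint.mem_iff.1 (PathSpace.qs_mem h 1 x)]
    noncomm_ring
  · simpa using l₁.star.mul l₂

lemma isFrame_of_hasDerivAt {g : ℝ → Mat n} (hg : ∀ x, HasDerivAt g (qs γ 1 x * g x) x)
    (l : Filter.Tendsto g Filter.atBot (𝓝 1)) : IsFrame n k γ g := by
  have hu : ∀ x, g x ∈ Matrix.unitaryGroup (Fin n) ℂ := fun x =>
    (Matrix.mem_unitaryGroup_iff').2 (PathSpace.star_mul_eq_one h hg hg l l x)
  have hq1 : ContDiff ℝ ∞ (qs γ 1) := contDiff_qs (PathSpace.contDiff h) 1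
  have hsmooth : ContDiff ℝ ∞ g := by
    refine contDiff_infty.2 fun N => ?_
    induction N with
    | zero =>
      exact contDiff_zero.2 (continuous_iff_continuousAt.2 fun x => (hg x).continuousAt)
    | succ N ih =>
      push_cast
      refine contDiff_succ_iff_deriv.2 ⟨fun x => (hg x).differentiableAt, by simp, ?_⟩
      rw [funext fun x => (hg x).deriv]
      exact (contDiff_infty.1 hq1 N).mul ih
  -- Constant in `x`, since `γ_x = [q_1, γ]`; the value is read off at `-∞`.
  have hconj : ∀ x, star (g x) * γ x * g x = base n k := by
    refine eq_of_hasDerivAt_zero_of_tendsto (fun x => ?_) ?_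
    · convert! PathSpace.hasDerivAt_conj h hg (PathSpace.hasDerivAt_self h x) using 1
      noncomm_ring
    · simpa using (l.star.mul h.2.2.1).mul l
  have hw : ∀ x, (g x)⁻¹ * deriv g x = star (g x) * qs γ 1 x * g x := fun x => by
    rw [(hg x).deriv, inv_eq_star (hu x), mul_assoc]
  have hgg : ∀ x, g x * star (g x) = 1 := fun x => (Matrix.mem_unitaryGroup_iff).1 (hu x)
  refine ⟨hsmooth, hu, fun x => ?_, l, fun x => ?_, ?_⟩
  · rw [← hconj x, inv_eq_star (hu x)]
    calc γ x = (g x * star (g x)) * γ x * (g x * star (g x)) := by rw [hgg]; simp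
      _ = _ := by noncomm_ring
  · rw [hw]
    refine ⟨skewAdjoint.conjugate' (PathSpace.qs_mem h 1 x) _, fun z _ hz => ?_⟩
    rw [ip, trace_mul_eq_zero (base_sq_real n k) ?_ (sub_eq_zero.1 hz)]
    · simp
    · rw [← hconj x]
      calc star (g x) * γ x * g x * (star (g x) * qs γ 1 x * g x)
          = star (g x) * γ x * (g x * star (g x)) * qs γ 1 x * g x := by noncomm_ring
        _ = star (g x) * (γ x * qs γ 1 x) * g x := by rw [hgg]; noncomm_ring
        _ = -(star (g x) * qs γ 1 x * (g x * star (g x)) * γ x * g x) := by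
            rw [PathSpace.qs_one_anticommute h, hgg]; noncomm_ring
        _ = _ := by noncomm_ring
  · rw [funext hw]
    -- Every derivative of `g⁻¹ q_1 g` is again a conjugate of a rapidly decaying map, and
    -- conjugation by a unitary preserves the norm; no bound on derivatives of `g` is needed.
    have key : ∀ m, ∃ A : ℝ → Mat n, (Rapid fun _ : ℝ => A) ∧
        deriv^[m] (fun x => star (g x) * qs γ 1 x * g x) = fun x => star (g x) * A x * g x := by
      intro m
      induction m with
      | zero => exact ⟨_, PathSpace.rapid_qs h 0, rfl⟩
      | succ m ih =>
        obtain ⟨A, hA, hm⟩ := ih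
        refine ⟨fun x => deriv A x + A x * qs γ 1 x - qs γ 1 x * A x,
          (hA.dX.add (hA.mul (PathSpace.tame_qs h 1))).sub
            (Decays.mul_left (PathSpace.tame_qs h 1) hA), ?_⟩
        rw [Function.iterate_succ_apply', hm]
        funext x
        exact (PathSpace.hasDerivAt_conj h hg (hA.smooth.hasDerivAt_dX 0 x)).deriv
    refine isSchwartz_of_bound ?_ fun p m => ?_
    · have : ContDiff ℝ ∞ fun x => star (g x) := (starL' ℝ : Mat n ≃L[ℝ] Mat n).contDiff.comp hsmooth
      exact (this.mul hq1).mul hsmooth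
    · obtain ⟨A, hA, hm⟩ := key m
      obtain ⟨C, hC⟩ := hA.bound 0 0 p trivial
      refine ⟨C, fun x => ?_⟩
      simp only [hm]
      rw [← inv_eq_star (hu x), norm_conj_unitary (hu x)]
      exact hC 0 (by simp) x

lemma existsUnique_frame : ∃! g, IsFrame n k γ g := by
  obtain ⟨C, -, hC⟩ := (PathSpace.rapid_qs h 0).exists_le
  obtain ⟨g, hg, l⟩ := exists_hasDerivAt_mul_tendsto_one
    (contDiff_qs (PathSpace.contDiff h) 1).continuous (hC 0 (by simp))
  have hF := PathSpace.isFrame_of_hasDerivAt h hg l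
  refine ⟨g, hF, fun g' hg' => funext fun x => ?_⟩
  have h1 := PathSpace.star_mul_eq_one h hg hg'.hasDerivAt l hg'.lim x
  rw [← inv_eq_star (hF.unitary x)] at h1
  rw [← mul_inv_cancel_unitary (hF.unitary x) (g' x), h1, mul_one]

lemma isFrame_frame : IsFrame n k γ (frame n k γ) :=
  Classical.epsilon_spec (PathSpace.existsUnique_frame h).exists

lemma isHierarchy : IsHierarchy n k (Phi n k γ)
    fun j x => (frame n k γ x)⁻¹ * qs γ j x * frame n k γ x := by
  have hF := PathSpace.isFrame_frame h
  have hd := hF.hasDerivAt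
  set g := frame n k γ with hgdef
  have hu := hF.unitary
  have hinv : ∀ x, (g x)⁻¹ = star (g x) := fun x => inv_eq_star (hu x)
  have hconj : ∀ x, (g x)⁻¹ * γ x * g x = base n k := fun x => by
    rw [hF.conj x]
    simp only [mul_assoc, inv_mul_unitary (hu x), mul_one, inv_mul_cancel_unitary (hu x)]
  refine ⟨fun j => ?_, fun j x => ?_, fun x => ?_, fun j hj => ?_, fun j x => ?_⟩
  · simp only [hinv]
    have : ContDiff ℝ ∞ fun x => star (g x) :=
      (starL' ℝ : Mat n ≃L[ℝ] Mat n).contDiff.comp hF.smooth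
    exact (this.mul (contDiff_qs (PathSpace.contDiff h) j)).mul hF.smooth
  · rw [hinv]
    exact skewAdjoint.conjugate' (PathSpace.qs_mem h j x) _
  · rw [qs_zero]; exact hconj x
  · obtain ⟨j, rfl⟩ := Nat.exists_eq_succ_of_ne_zero (by omega : j ≠ 0)
    rw [tendsto_zero_iff_norm_tendsto_zero]
    simp only [norm_conj_unitary (hu _)]
    exact ((PathSpace.rapid_qs h j).tendsto_atBot (s := 0) (by simp)).norm.trans (by simp)
  · have h1 := (PathSpace.hasDerivAt_conj h hd (PathSpace.hasDerivAt_qs h j x)).deriv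
    simp only [← hinv] at h1
    rw [h1, Phi, ← hgdef, (hd x).deriv, ← hconj x, Ring.lie_def, Ring.lie_def]
    have hgg : ∀ y, g x * ((g x)⁻¹ * y) = y := mul_inv_cancel_unitary (hu x)
    simp only [mul_assoc, hgg]
    noncomm_ring

/-- If two solutions agree at level `j`, their difference `D` at level `j + 1` commutes with `a`. In
the equation for `D_x` the term `D_x` commutes with `a` while the two brackets anticommute with it,
so `D_x = 0`, and `D` vanishes at `-∞`. -/
lemma existsUnique_hierarchy : ∃! Q, IsHierarchy n k (Phi n k γ) Q := by
  have hF := PathSpace.isFrame_frame h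
  refine ⟨_, PathSpace.isHierarchy h, fun Q hQ => ?_⟩
  have hQ' := PathSpace.isHierarchy h
  set Q' : ℕ → ℝ → Mat n := fun j x => (frame n k γ x)⁻¹ * qs γ j x * frame n k γ x
  funext j
  induction j with
  | zero => funext x; rw [hQ.zero, hQ'.zero]
  | succ j ih =>
    set a := base n k
    have hsq : a * a = -((1 / 4 : ℝ) • (1 : Mat n)) := base_sq_real n k
    have hd : ∀ x, HasDerivAt (fun x => Q (j + 1) x - Q' (j + 1) x)
        (deriv (Q (j + 1)) x - deriv (Q' (j + 1)) x) x := fun x =>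
      ((hQ.smooth _).differentiable (by simp) x).hasDerivAt.sub
        ((hQ'.smooth _).differentiable (by simp) x).hasDerivAt
    have hcomm : ∀ x, a * (Q (j + 1) x - Q' (j + 1) x) = (Q (j + 1) x - Q' (j + 1) x) * a := by
      intro x
      have h1 : ⁅Q (j + 1) x, a⁆ = ⁅Q' (j + 1) x, a⁆ := by rw [← hQ.step, ← hQ'.step, ih]
      rw [Ring.lie_def, Ring.lie_def, sub_eq_sub_iff_add_eq_add] at h1
      rw [mul_sub, sub_mul, sub_eq_sub_iff_add_eq_add, add_comm, ← h1, add_comm]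
    have hder : ∀ x, deriv (Q (j + 1)) x - deriv (Q' (j + 1)) x = 0 := by
      intro x
      have hw : a * Phi n k γ x = -(Phi n k γ x * a) := centPerp_anticommute (hF.perp x)
      set w := Phi n k γ x
      set D := Q (j + 1) x - Q' (j + 1) x with hD
      set E := Q (j + 1 + 1) x - Q' (j + 1 + 1) x with hE
      have h1 : a * (deriv (Q (j + 1)) x - deriv (Q' (j + 1)) x) =
          (deriv (Q (j + 1)) x - deriv (Q' (j + 1)) x) * a :=
        (((hd x).const_mul a).congr_deriv rfl).unique
          (by simpa only [hcomm] using (hd x).mul_const a)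
      have h2 : deriv (Q (j + 1)) x - deriv (Q' (j + 1)) x +
          ((w * D - D * w) - (E * a - a * E)) = 0 := by
        have e1 := hQ.step (j + 1) x
        have e2 := hQ'.step (j + 1) x
        rw [Ring.lie_def, Ring.lie_def] at e1 e2
        have e3 : deriv (Q (j + 1)) x = Q (j + 1 + 1) x * a - a * Q (j + 1 + 1) x -
          (w * Q (j + 1) x - Q (j + 1) x * w) := eq_sub_of_add_eq e1
        have e4 : deriv (Q' (j + 1)) x = Q' (j + 1 + 1) x * a - a * Q' (j + 1 + 1) x -
          (w * Q' (j + 1) x - Q' (j + 1) x * w) := eq_sub_of_add_eq e2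
        rw [e3, e4, hD, hE]
        noncomm_ring
      have hcx : a * D = D * a := hcomm x
      refine (eq_zero_of_commute_of_anticommute hsq h1 ?_ h2).1
      have t1 : a * (w * D) = -(w * D * a) := by
        rw [← mul_assoc, hw, neg_mul, mul_assoc, hcx, mul_assoc]
      have t2 : a * (D * w) = -(D * w * a) := by
        rw [← mul_assoc, hcx, mul_assoc, hw, mul_neg, mul_assoc]
      simp only [mul_sub, sub_mul, t1, t2, sq_mul_of_sq hsq, mul_sq_of_sq hsq, mul_assoc]
      abel
    have hlim : Filter.Tendsto (fun x => Q (j + 1) x - Q' (j + 1) x) Filter.atBot (𝓝 0) := by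
      simpa using (hQ.lim (j + 1) (by omega)).sub (hQ'.lim (j + 1) (by omega))
    funext x
    exact sub_eq_zero.1 (eq_of_hasDerivAt_zero_of_tendsto
      (fun x => by simpa only [hder] using hd x) hlim x)

lemma Qseq_eq (j : ℕ) (x : ℝ) : Qseq n k (Phi n k γ) j x =
    (frame n k γ x)⁻¹ * qs γ j x * frame n k γ x := by
  have h1 : IsHierarchy n k (Phi n k γ) (Qseq n k (Phi n k γ)) :=
    Classical.epsilon_spec (PathSpace.existsUnique_hierarchy h).exists
  rw [(PathSpace.existsUnique_hierarchy h).unique h1 (PathSpace.isHierarchy h)]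

lemma conj_Qseq (j : ℕ) (x : ℝ) :
    frame n k γ x * Qseq n k (Phi n k γ) j x * (frame n k γ x)⁻¹ = qs γ j x := by
  have hu := (PathSpace.isFrame_frame h).unitary x
  rw [PathSpace.Qseq_eq h, mul_assoc, mul_assoc, mul_assoc, mul_inv_unitary hu,
    mul_inv_cancel_unitary hu, mul_one]

lemma conj_Qseq_lie (j : ℕ) (x : ℝ) : frame n k γ x * ⁅Qseq n k (Phi n k γ) j x, base n k⁆ *
    (frame n k γ x)⁻¹ = ⁅qs γ j x, γ x⁆ := by
  have hF := PathSpace.isFrame_frame h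
  have hu := hF.unitary x
  rw [PathSpace.Qseq_eq h, hF.conj x, Ring.lie_def, Ring.lie_def]
  simp only [mul_sub, sub_mul, mul_assoc, mul_inv_cancel_unitary hu]
  simp only [← mul_assoc, ← hF.conj x, mul_inv_unitary hu, mul_one]

lemma trace_Qseq (j : ℕ) (x : ℝ) : Matrix.trace (Qseq n k (Phi n k γ) j x * base n k) =
    Matrix.trace (qs γ j x * γ x) := by
  have key : ∀ G q a : Mat n, Matrix.trace (G⁻¹ * q * G * a) = Matrix.trace (q * (G * a * G⁻¹)) :=
    fun G q a => by rw [mul_assoc, mul_assoc, Matrix.trace_mul_comm]; simp only [mul_assoc]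
  rw [PathSpace.Qseq_eq h, key, ← (PathSpace.isFrame_frame h).conj x]

end PathSpace

/-! ### Variation of the Hamiltonians -/

/-- The trace identity behind the variational formula: `q` solves `X q_x = [q, g]`, and `δ`, `E` are
derivations with `δ (q²) = E (q²) = 0`, `E g = 0`, `E X = X`. -/
lemma trace_total_derivative {A : Type*} [Ring A] [Algebra ℝ A] (τ : A →ₗ[ℝ] ℂ)
    (hτ : ∀ x y, τ (x * y) = τ (y * x)) {X q δq Eq g δg qx δqx Eqx : A}
    (hX : ∀ y, y * X = X * y) (hqx : X * qx = q * g - g * q)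
    (hδqx : X * δqx = δq * g - g * δq + (q * δg - δg * q))
    (hEqx : X * Eqx = Eq * g - g * Eq - (q * g - g * q))
    (hqq : q * q = -((1 / 4 : ℝ) • 1)) (hqδ : q * δq = -(δq * q)) (hqE : q * Eq = -(Eq * q)) :
    τ (X * (qx * (δq * Eq - Eq * δq) + q * (δqx * Eq + δq * Eqx - (Eqx * δq + Eq * δqx)))) =
      -τ (δg * Eq) - τ (δq * g) := by
  set M := q * (δq * Eq - Eq * δq) with hM
  -- After elimination of the `x`-derivatives there remain a commutator with `g`, of trace zero, and
  -- two groups of one shape, with `(v, w) = (δg, Eq)` and `(g, δq)`.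
  have e : X * (qx * (δq * Eq - Eq * δq) + q * (δqx * Eq + δq * Eqx - (Eqx * δq + Eq * δqx))) =
      (M * g - g * M) + (q * q * δg * Eq - q * δg * q * Eq - q * Eq * q * δg + q * Eq * δg * q) +
        (q * q * g * δq - q * g * q * δq - q * δq * q * g + q * δq * g * q) := by
    have : X * (qx * (δq * Eq - Eq * δq) + q * (δqx * Eq + δq * Eqx - (Eqx * δq + Eq * δqx))) =
        (X * qx) * (δq * Eq - Eq * δq) + q * ((X * δqx) * Eq + δq * (X * Eqx) -
          ((X * Eqx) * δq + Eq * (X * δqx))) := by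
      simp only [mul_add, mul_sub, ← mul_assoc, hX]
    rw [this, hqx, hδqx, hEqx, hM]
    noncomm_ring
  -- Each of the four terms contributes `-1/4` of `τ (v * w)`, by cyclicity and `q² = -1/4`.
  have hc : ∀ v w : A, q * w = -(w * q) →
      τ (q * q * v * w - q * v * q * w - q * w * q * v + q * w * v * q) = -τ (v * w) := by
    intro v w hw
    have h1 : τ (q * v * q * w) = (1 / 4 : ℝ) • τ (v * w) := by
      rw [mul_assoc, mul_assoc, hτ,
        show v * (q * w) * q = v * (q * w * q) by noncomm_ring, hw, neg_mul, mul_sq_of_sq hqq,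
        neg_neg, mul_smul_comm, map_smul]
    have h2 : τ (q * w * q * v) = (1 / 4 : ℝ) • τ (v * w) := by
      rw [hw, neg_mul, mul_sq_of_sq hqq, neg_neg, smul_mul_assoc, map_smul, hτ]
    have h3 : τ (q * w * v * q) = -((1 / 4 : ℝ) • τ (v * w)) := by
      rw [hτ, mul_assoc, sq_mul_of_sq hqq, map_neg, map_smul, hτ]
    have h4 : τ (q * q * v * w) = -((1 / 4 : ℝ) • τ (v * w)) := by
      rw [hqq]; simp
    rw [map_add, map_sub, map_sub, h1, h2, h3, h4]
    module
  rw [e, map_add, map_add, map_sub, hτ M g, hc _ _ hqE, hc _ _ hqδ, hτ g δq]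
  ring

lemma Smooth2.sub {n : ℕ} {f g : ℝ → ℝ → Mat n} (hf : Smooth2 f) (hg : Smooth2 g) :
    Smooth2 (f - g) := ContDiff.sub hf hg

lemma Smooth2.sum {n : ℕ} {ι : Type*} {t : Finset ι} {F : ι → ℝ → ℝ → Mat n}
    (h : ∀ i ∈ t, Smooth2 (F i)) : Smooth2 (∑ i ∈ t, F i) :=
  Finset.sum_induction _ Smooth2 (fun _ _ => Smooth2.add) Smooth2.zero h

lemma Smooth2.dX_sum {n : ℕ} {ι : Type*} {t : Finset ι} {F : ι → ℝ → ℝ → Mat n}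
    (h : ∀ i ∈ t, Smooth2 (F i)) : GrassmannFlow.dX (∑ i ∈ t, F i) =
      ∑ i ∈ t, GrassmannFlow.dX (F i) := by
  funext s x
  have := HasDerivAt.sum fun i hi => (h i hi).hasDerivAt_dX s x
  simpa [GrassmannFlow.dX, Finset.sum_apply] using this.deriv

lemma Smooth2.dS_sum {n : ℕ} {ι : Type*} {t : Finset ι} {F : ι → ℝ → ℝ → Mat n}
    (h : ∀ i ∈ t, Smooth2 (F i)) : GrassmannFlow.dS (∑ i ∈ t, F i) =
      ∑ i ∈ t, GrassmannFlow.dS (F i) := by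
  funext s x
  have := HasDerivAt.fun_sum fun i hi => (h i hi).hasDerivAt_dS s x
  simpa [GrassmannFlow.dS, Finset.sum_apply] using this.deriv

lemma Smooth2.dX_sub {n : ℕ} {f g : ℝ → ℝ → Mat n} (hf : Smooth2 f) (hg : Smooth2 g) :
    GrassmannFlow.dX (f - g) = GrassmannFlow.dX f - GrassmannFlow.dX g := by
  funext s x
  exact ((hf.hasDerivAt_dX s x).sub (hg.hasDerivAt_dX s x)).deriv

lemma Smooth2.dS_sub {n : ℕ} {f g : ℝ → ℝ → Mat n} (hf : Smooth2 f) (hg : Smooth2 g) :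
    GrassmannFlow.dS (f - g) = GrassmannFlow.dS f - GrassmannFlow.dS g := by
  funext s x
  exact ((hf.hasDerivAt_dS s x).sub (hg.hasDerivAt_dS s x)).deriv

/-! ### The transgression identity for generating series -/

/-- The coefficientwise partial derivative in `x` of a power series of two-variable functions. -/
def seriesDX {n : ℕ} (F : PowerSeries (ℝ → ℝ → Mat n)) : PowerSeries (ℝ → ℝ → Mat n) :=
  PowerSeries.mk fun j => dX (PowerSeries.coeff j F)

lemma seriesDX_mul {n : ℕ} {F G : PowerSeries (ℝ → ℝ → Mat n)}
    (hF : ∀ j, Smooth2 (PowerSeries.coeff j F)) (hG : ∀ j, Smooth2 (PowerSeries.coeff j G)) :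
    seriesDX (F * G) = seriesDX F * G + F * seriesDX G := by
  ext1 j
  simp only [seriesDX, PowerSeries.coeff_mk, PowerSeries.coeff_mul, map_add]
  rw [Smooth2.dX_sum fun p _ => (hF p.1).mul (hG p.2), ← Finset.sum_add_distrib]
  exact Finset.sum_congr rfl fun p _ => (hF p.1).dX_mul (hG p.2)

/-- The trace at a point of a coefficient of a power series. -/
def traceCoeff {n : ℕ} (m : ℕ) (s x : ℝ) : PowerSeries (ℝ → ℝ → Mat n) →ₗ[ℝ] ℂ where
  toFun F := Matrix.trace (PowerSeries.coeff m F s x)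
  map_add' F G := by simp
  map_smul' c F := by
    rw [PowerSeries.coeff_smul]
    simp

lemma traceCoeff_mul_comm {n : ℕ} (m : ℕ) (s x : ℝ) (F G : PowerSeries (ℝ → ℝ → Mat n)) :
    traceCoeff m s x (F * G) = traceCoeff m s x (G * F) := by
  simp only [traceCoeff, LinearMap.coe_mk, AddHom.coe_mk, PowerSeries.coeff_mul, Finset.sum_apply,
    Matrix.trace_sum, Pi.mul_apply]
  rw [← Finset.Nat.sum_antidiagonal_swap]
  exact Finset.sum_congr rfl fun p _ => Matrix.trace_mul_comm _ _

section Family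

variable {n : ℕ} {Γ : ℝ → ℝ → Mat n} (hΓ : Smooth2 Γ)
  (hsq : ∀ s x, Γ s x * Γ s x = -((1 / 4 : ℝ) • (1 : Mat n)))

/-- The generating series `∑ q_j Xʲ` of a family of paths. -/
def genSeries (Γ : ℝ → ℝ → Mat n) : PowerSeries (ℝ → ℝ → Mat n) :=
  PowerSeries.mk fun j s => qs (Γ s) j

/-- The derivative of the generating series in the parameter of the family. -/
def genSeriesDS (Γ : ℝ → ℝ → Mat n) : PowerSeries (ℝ → ℝ → Mat n) :=
  PowerSeries.mk fun j => dS fun s => qs (Γ s) j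

/-- The Euler derivative `∑ j q_j Xʲ` of the generating series. -/
def genSeriesEuler (Γ : ℝ → ℝ → Mat n) : PowerSeries (ℝ → ℝ → Mat n) :=
  PowerSeries.mk fun j => (j : ℝ) • fun s => qs (Γ s) j

include hΓ in
lemma smooth2_coeff_genSeries (j : ℕ) :
    Smooth2 (PowerSeries.coeff j (genSeries Γ)) ∧ Smooth2 (PowerSeries.coeff j (genSeriesDS Γ)) ∧
      Smooth2 (PowerSeries.coeff j (genSeriesEuler Γ)) := by
  simp only [genSeries, genSeriesDS, genSeriesEuler, PowerSeries.coeff_mk]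
  exact ⟨smooth2_qs hΓ j, (smooth2_qs hΓ j).dS, (smooth2_qs hΓ j).const_smul _⟩

include hΓ hsq

lemma dX_qs (j : ℕ) : dX (fun s => qs (Γ s) j) =
    (fun s => qs (Γ s) (j + 1)) * Γ - Γ * fun s => qs (Γ s) (j + 1) := by
  funext s x
  exact deriv_qs (hΓ.contDiff_right s) (hsq s) j x

/-- All the differential relations in one equation. Multiplication by `X` shifts the index, and the
constant coefficient is `[γ, γ] = 0`. -/
lemma X_mul_seriesDX_genSeries : PowerSeries.X * seriesDX (genSeries Γ) =
    genSeries Γ * PowerSeries.C Γ - PowerSeries.C Γ * genSeries Γ := by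
  ext1 j
  cases j with
  | zero =>
    simp [genSeries, qs_zero]
  | succ j =>
    rw [PowerSeries.coeff_succ_X_mul, map_sub, PowerSeries.coeff_mul_C, PowerSeries.coeff_C_mul]
    simp only [genSeries, seriesDX, PowerSeries.coeff_mk]
    exact dX_qs hΓ hsq j

lemma X_mul_seriesDX_genSeriesDS : PowerSeries.X * seriesDX (genSeriesDS Γ) =
    genSeriesDS Γ * PowerSeries.C Γ - PowerSeries.C Γ * genSeriesDS Γ +
      (genSeries Γ * PowerSeries.C (dS Γ) - PowerSeries.C (dS Γ) * genSeries Γ) := by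
  ext1 j
  cases j with
  | zero =>
    simp [genSeries, genSeriesDS, qs_zero]
  | succ j =>
    rw [PowerSeries.coeff_succ_X_mul, map_add, map_sub, map_sub, PowerSeries.coeff_mul_C,
      PowerSeries.coeff_C_mul, PowerSeries.coeff_mul_C, PowerSeries.coeff_C_mul]
    simp only [genSeries, genSeriesDS, seriesDX, PowerSeries.coeff_mk]
    have h := smooth2_qs hΓ (j + 1)
    rw [(smooth2_qs hΓ j).dX_dS, dX_qs hΓ hsq j, (h.mul hΓ).dS_sub (hΓ.mul h), h.dS_mul hΓ,
      hΓ.dS_mul h]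
    abel

/-- The extra commutator is the index shift: the coefficient of degree `j + 1` on the left carries
the Euler weight `j` instead of `j + 1`. -/
lemma X_mul_seriesDX_genSeriesEuler : PowerSeries.X * seriesDX (genSeriesEuler Γ) =
    genSeriesEuler Γ * PowerSeries.C Γ - PowerSeries.C Γ * genSeriesEuler Γ -
      (genSeries Γ * PowerSeries.C Γ - PowerSeries.C Γ * genSeries Γ) := by
  ext1 j
  cases j with
  | zero =>
    simp [genSeries, genSeriesEuler, qs_zero]
  | succ j =>
    rw [PowerSeries.coeff_succ_X_mul, map_sub, map_sub, map_sub, PowerSeries.coeff_mul_C,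
      PowerSeries.coeff_C_mul, PowerSeries.coeff_mul_C, PowerSeries.coeff_C_mul]
    simp only [genSeries, genSeriesEuler, seriesDX, PowerSeries.coeff_mk]
    rw [(smooth2_qs hΓ j).dX_const_smul, dX_qs hΓ hsq j, smul_mul_assoc, mul_smul_comm]
    push_cast
    module

lemma genSeries_sq : genSeries Γ * genSeries Γ = -((1 / 4 : ℝ) • 1) := by
  ext1 j
  rw [PowerSeries.coeff_mul, Finset.Nat.sum_antidiagonal_eq_sum_range_succ_mk, map_neg,
    PowerSeries.coeff_smul, PowerSeries.coeff_one]
  simp only [genSeries, PowerSeries.coeff_mk]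
  funext s x
  cases j with
  | zero => simpa [qs_zero] using hsq s x
  | succ j =>
    have := sum_qs_mul_qs (hΓ.contDiff_right s) (hsq s) (j + 1) (by omega) x
    simpa [Finset.sum_apply] using this

lemma sum_antidiagonal_qs (j : ℕ) : ∃ c : Mat n, (j ≠ 0 → c = 0) ∧
    ∑ p ∈ Finset.HasAntidiagonal.antidiagonal j, ((fun s => qs (Γ s) p.1) * fun s => qs (Γ s) p.2) =
      fun _ _ => c := by
  have h := congrArg (PowerSeries.coeff j) (genSeries_sq hΓ hsq)
  rw [PowerSeries.coeff_mul, map_neg, PowerSeries.coeff_smul, PowerSeries.coeff_one] at h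
  simp only [genSeries, PowerSeries.coeff_mk] at h
  rw [h]
  split_ifs with h0
  · exact ⟨-((1 / 4 : ℝ) • 1), fun h => absurd h0 h, rfl⟩
  · exact ⟨0, fun _ => rfl, by funext s x; simp⟩

lemma genSeries_mul_genSeriesDS :
    genSeries Γ * genSeriesDS Γ = -(genSeriesDS Γ * genSeries Γ) := by
  rw [eq_neg_iff_add_eq_zero]
  ext1 j
  obtain ⟨c, -, hc⟩ := sum_antidiagonal_qs hΓ hsq j
  have h1 : dS (fun _ _ => c) = 0 := by funext s x; simp [dS]
  rw [← hc, Smooth2.dS_sum fun p _ => (smooth2_qs hΓ p.1).mul (smooth2_qs hΓ p.2)] at h1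
  rw [map_add, PowerSeries.coeff_mul, PowerSeries.coeff_mul, ← Finset.sum_add_distrib, map_zero,
    ← h1]
  refine Finset.sum_congr rfl fun p _ => ?_
  rw [(smooth2_qs hΓ p.1).dS_mul (smooth2_qs hΓ p.2), add_comm]
  simp [genSeries, genSeriesDS]

/-- The Euler derivation applied to the square of the series: its degree `j` coefficient gets the
factor `j`, and only the degree `0` coefficient of the square is nonzero. -/
lemma genSeries_mul_genSeriesEuler :
    genSeries Γ * genSeriesEuler Γ = -(genSeriesEuler Γ * genSeries Γ) := by
  rw [eq_neg_iff_add_eq_zero]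
  ext1 j
  obtain ⟨c, hc0, hc⟩ := sum_antidiagonal_qs hΓ hsq j
  have h1 : (j : ℝ) • ∑ p ∈ Finset.HasAntidiagonal.antidiagonal j,
      ((fun s => qs (Γ s) p.1) * fun s => qs (Γ s) p.2) = 0 := by
    rw [hc]
    rcases eq_or_ne j 0 with rfl | h
    · simp
    · rw [hc0 h]; funext s x; simp
  rw [map_add, PowerSeries.coeff_mul, PowerSeries.coeff_mul, ← Finset.sum_add_distrib, map_zero,
    ← h1, Finset.smul_sum]
  refine Finset.sum_congr rfl fun p hp => ?_
  rw [← Finset.HasAntidiagonal.mem_antidiagonal.1 hp]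
  simp only [genSeries, genSeriesEuler, PowerSeries.coeff_mk, smul_mul_assoc, mul_smul_comm]
  push_cast
  module

lemma trace_dX_transgression (m : ℕ) (s x : ℝ) :
    Matrix.trace (dX (PowerSeries.coeff m (genSeries Γ * (genSeriesDS Γ * genSeriesEuler Γ -
      genSeriesEuler Γ * genSeriesDS Γ))) s x) =
    -(((m + 1 : ℕ) : ℝ) • Matrix.trace (dS Γ s x * qs (Γ s) (m + 1) x)) -
      Matrix.trace (dS (fun s => qs (Γ s) (m + 1)) s x * Γ s x) := by
  have hs := smooth2_coeff_genSeries hΓ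
  have hde : ∀ {F G : PowerSeries (ℝ → ℝ → Mat n)}, (∀ j, Smooth2 (PowerSeries.coeff j F)) →
      (∀ j, Smooth2 (PowerSeries.coeff j G)) → ∀ j, Smooth2 (PowerSeries.coeff j (F * G)) := by
    intro F G hF hG j
    rw [PowerSeries.coeff_mul]
    exact Smooth2.sum fun p _ => (hF p.1).mul (hG p.2)
  have h1 := hde (fun j => (hs j).2.1) (fun j => (hs j).2.2)
  have h2 := hde (fun j => (hs j).2.2) (fun j => (hs j).2.1)
  have hsub : seriesDX (genSeriesDS Γ * genSeriesEuler Γ - genSeriesEuler Γ * genSeriesDS Γ) =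
      seriesDX (genSeriesDS Γ * genSeriesEuler Γ) -
        seriesDX (genSeriesEuler Γ * genSeriesDS Γ) := by
    ext1 j
    simp only [seriesDX, PowerSeries.coeff_mk, map_sub]
    exact (h1 j).dX_sub (h2 j)
  have key := trace_total_derivative (traceCoeff (m + 1) s x) (traceCoeff_mul_comm (m + 1) s x)
    (fun y => (PowerSeries.commute_X y).eq) (X_mul_seriesDX_genSeries hΓ hsq)
    (X_mul_seriesDX_genSeriesDS hΓ hsq) (X_mul_seriesDX_genSeriesEuler hΓ hsq)
    (genSeries_sq hΓ hsq) (genSeries_mul_genSeriesDS hΓ hsq) (genSeries_mul_genSeriesEuler hΓ hsq)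
  rw [← seriesDX_mul (fun j => (hs j).2.1) (fun j => (hs j).2.2),
    ← seriesDX_mul (fun j => (hs j).2.2) (fun j => (hs j).2.1), ← hsub,
    ← seriesDX_mul (fun j => (hs j).1) (fun j => by rw [map_sub]; exact (h1 j).sub (h2 j))] at key
  simp only [traceCoeff, LinearMap.coe_mk, AddHom.coe_mk, PowerSeries.coeff_succ_X_mul] at key
  rw [PowerSeries.coeff_C_mul, PowerSeries.coeff_mul_C] at key
  simp only [seriesDX, genSeriesEuler, genSeriesDS, PowerSeries.coeff_mk] at key
  simp only [genSeriesEuler, genSeriesDS]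
  rw [key, ← Matrix.trace_smul, ← mul_smul_comm]
  rfl

end Family

/-! ### Integration of the transgression identity -/

/-- The real part of the trace, as a continuous linear map. -/
def reTrace (n : ℕ) : Mat n →L[ℝ] ℝ :=
  LinearMap.toContinuousLinearMap (Complex.reLm ∘ₗ (Matrix.traceLinearMap (Fin n) ℝ ℂ))

namespace Decays

variable {n : ℕ} {f : ℝ → ℝ → Mat n}

lemma integrable_reTrace (hf : Rapid f) {s : ℝ} (hs : s ∈ Set.Icc (-1 : ℝ) 1) :
    MeasureTheory.Integrable fun x => (Matrix.trace (f s x)).re :=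
  (reTrace n).integrable_comp (hf.integrable hs)

lemma integral_reTrace_dX (hf : Rapid f) {s : ℝ} (hs : s ∈ Set.Icc (-1 : ℝ) 1) :
    ∫ x, (Matrix.trace (dX f s x)).re = 0 := by
  have := (reTrace n).integral_comp_comm (hf.dX.integrable hs)
  rw [hf.integral_dX hs, map_zero] at this
  exact this

lemma hasDerivAt_integral_reTrace (hf : Rapid f) :
    HasDerivAt (fun s => ∫ x, (Matrix.trace (f s x)).re)
      (∫ x, (Matrix.trace (dS f 0 x)).re) 0 := by
  obtain ⟨C, hC0, hC⟩ := hf.dS.exists_le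
  have hmem : ∀ {s : ℝ}, s ∈ Metric.ball (0 : ℝ) 1 → s ∈ Set.Icc (-1 : ℝ) 1 := fun hs => by
    rw [Real.ball_eq_Ioo] at hs
    constructor <;> linarith [hs.1, hs.2]
  refine (hasDerivAt_integral_of_dominated_loc_of_deriv_le
    (F := fun s x => reTrace n (f s x)) (F' := fun s x => reTrace n (dS f s x))
    (bound := fun x => ‖reTrace n‖ * (C * (1 + x ^ 2)⁻¹))
    (Metric.ball_mem_nhds (0 : ℝ) one_pos) ?_ ?_ ?_ ?_ ?_ ?_).2
  · exact Filter.Eventually.of_forall fun s =>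
      ((reTrace n).continuous.comp (hf.continuous_right s)).aestronglyMeasurable
  · exact (reTrace n).integrable_comp (hf.integrable (by simp))
  · exact ((reTrace n).continuous.comp (hf.dS.continuous_right 0)).aestronglyMeasurable
  · refine Filter.Eventually.of_forall fun x s hs => ?_
    exact ((reTrace n).le_opNorm _).trans (by gcongr; exact hC s (hmem hs) x)
  · exact (integrable_inv_one_add_sq.const_mul C).const_mul _
  · exact Filter.Eventually.of_forall fun x s _ =>
      (reTrace n).hasFDerivAt.comp_hasDerivAt s (hf.smooth.hasDerivAt_dS s x)

end Decays

namespace IsVariation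

variable {n k : ℕ} {γ : ℝ → Mat n} {Γ : ℝ → ℝ → Mat n} (h : IsVariation n k γ Γ)

include h

lemma sq (s x : ℝ) : Γ s x * Γ s x = -((1 / 4 : ℝ) • (1 : Mat n)) := PathSpace.sq (h.mem s) x

/-- The variation of `q_0 = Γ` is merely bounded. Decay comes from the Euler factor, whose degree
`0` coefficient vanishes. -/
lemma rapid_transgression (m : ℕ) : Rapid (PowerSeries.coeff m (genSeries Γ *
    (genSeriesDS Γ * genSeriesEuler Γ - genSeriesEuler Γ * genSeriesDS Γ))) := by
  have hq : ∀ j, Tame fun s => qs (Γ s) j := tame_qs h.tame h.rapid_dX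
  have hE : ∀ j : ℕ, Rapid ((j : ℝ) • fun s => qs (Γ s) j) := by
    intro j
    cases j with
    | zero => simpa using Decays.zero
    | succ j => exact (rapid_qs_succ h.tame h.rapid_dX j).const_smul _
  rw [PowerSeries.coeff_mul]
  refine Decays.sum fun p _ => Decays.mul_left ?_ ?_
  · simpa only [genSeries, PowerSeries.coeff_mk] using hq p.1
  · rw [map_sub, PowerSeries.coeff_mul, PowerSeries.coeff_mul]
    simp only [genSeriesDS, genSeriesEuler, PowerSeries.coeff_mk]
    exact (Decays.sum fun r _ => Decays.mul_left (hq r.1).dS (hE r.2)).sub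
      (Decays.sum fun r _ => (hE r.1).mul (hq r.2).dS)

lemma dS_anticommute (x : ℝ) : γ x * dS Γ 0 x = -(dS Γ 0 x * γ x) := by
  have hs : Smooth2 Γ := h.smooth
  have h1 := (hs.hasDerivAt_dS 0 x).mul (hs.hasDerivAt_dS 0 x)
  have h2 : ((fun r => Γ r x) * fun r => Γ r x) = fun _ => -((1 / 4 : ℝ) • (1 : Mat n)) :=
    funext fun r => h.sq r x
  rw [h2] at h1
  have h3 := h1.unique (hasDerivAt_const _ _)
  rw [h.zero, add_comm] at h3
  exact eq_neg_of_add_eq_zero_left h3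

/-- The transgression identity trades `tr(δq_{m+1} γ)` for `-(m+1) tr(δγ q_{m+1})` up to an exact
derivative; the term `tr(q_{m+1} δγ)` of the product rule leaves the factor `-m`. -/
lemma hasDerivAt_integral_trace_qs (m : ℕ) :
    HasDerivAt (fun s => ∫ x, (Matrix.trace (qs (Γ s) (m + 1) x * Γ s x)).re)
      (-(m : ℝ) * ∫ x, (Matrix.trace (dS Γ 0 x * qs γ (m + 1) x)).re) 0 := by
  have hs : Smooth2 Γ := h.smooth
  have hq := rapid_qs_succ h.tame h.rapid_dX m
  have h1 := (hq.mul h.tame).hasDerivAt_integral_reTrace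
  have hT := h.rapid_transgression m
  convert! h1 using 1
  have e : ∀ x, (Matrix.trace (dS ((fun s => qs (Γ s) (m + 1)) * Γ) 0 x)).re =
      -(m : ℝ) * (Matrix.trace (dS Γ 0 x * qs γ (m + 1) x)).re -
        (Matrix.trace (dX (PowerSeries.coeff m (genSeries Γ *
          (genSeriesDS Γ * genSeriesEuler Γ - genSeriesEuler Γ * genSeriesDS Γ))) 0 x)).re := by
    intro x
    rw [trace_dX_transgression hs h.sq, hq.smooth.dS_mul hs]
    simp only [Pi.add_apply, Pi.mul_apply, Matrix.trace_add, h.zero, Complex.sub_re,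
      Complex.neg_re, Complex.add_re, Complex.real_smul, Complex.re_ofReal_mul]
    rw [Matrix.trace_mul_comm (qs γ (m + 1) x)]
    push_cast
    ring
  have hI : MeasureTheory.Integrable fun x => (Matrix.trace (dS Γ 0 x * qs γ (m + 1) x)).re := by
    have := (Decays.mul_left h.tame.dS hq).integrable_reTrace (s := 0) (by simp)
    simpa only [Pi.mul_apply, h.zero] using this
  rw [funext e, MeasureTheory.integral_sub (hI.const_mul _) (hT.dX.integrable_reTrace (by simp)),
    hT.integral_reTrace_dX (by simp), MeasureTheory.integral_const_mul, sub_zero]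

end IsVariation

/-! ### The Hamiltonian vector fields -/

/-- The vector field `[q_{j+2}, γ] = g [Q_{j+2}, a] g⁻¹` along `γ`. -/
def hamField {n : ℕ} (γ : ℝ → Mat n) (j : ℕ) : ℝ → Mat n := fun x => ⁅qs γ (j + 2) x, γ x⁆

lemma lie_anticommute {n : ℕ} {y q : Mat n} (hy : y * y = -((1 / 4 : ℝ) • (1 : Mat n))) :
    y * ⁅q, y⁆ = -(⁅q, y⁆ * y) := by
  rw [Ring.lie_def, mul_sub, sub_mul, sq_mul_of_sq hy, mul_sq_of_sq hy, mul_assoc]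
  abel

lemma tangent_anticommute {n : ℕ} {y v : Mat n} (hy : y * y = -((1 / 4 : ℝ) • (1 : Mat n)))
    (hv : v ∈ tangent y) : y * v = -(v * y) := by
  obtain ⟨z, -, rfl⟩ := hv
  exact lie_anticommute hy

/-- `[y, [q, y]]` is the tangential part of `q` at `y`, and a tangent vector `v` pairs only with
that part. -/
lemma trace_lie_lie_mul {n : ℕ} {y q v : Mat n} (hy : y * y = -((1 / 4 : ℝ) • (1 : Mat n)))
    (hv : y * v = -(v * y)) : Matrix.trace (⁅y, ⁅q, y⁆⁆ * v) = Matrix.trace (q * v) := by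
  have h1 : Matrix.trace (y * q * y * v) = (1 / 4 : ℝ) • Matrix.trace (q * v) := by
    rw [mul_assoc, mul_assoc, Matrix.trace_mul_comm, mul_assoc, hv, neg_mul, mul_sq_of_sq hy,
      neg_neg, mul_smul_comm, Matrix.trace_smul]
  have e : ⁅y, ⁅q, y⁆⁆ * v = (2 : ℝ) • (y * q * y * v) + (1 / 2 : ℝ) • (q * v) := by
    have : ⁅y, ⁅q, y⁆⁆ * v = (2 : ℝ) • (y * q * y * v) - y * y * q * v - q * (y * y) * v := by
      rw [Ring.lie_def, Ring.lie_def, two_smul]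
      noncomm_ring
    rw [this, hy]
    simp only [neg_mul, mul_neg, smul_mul_assoc, mul_smul_comm, one_mul, mul_one]
    module
  rw [e, Matrix.trace_add, Matrix.trace_smul, Matrix.trace_smul, h1]
  module

lemma tauDensity_hamField {n : ℕ} {γ Y : ℝ → Mat n} {j : ℕ} {x : ℝ}
    (hsq : γ x * γ x = -((1 / 4 : ℝ) • (1 : Mat n))) (hY : γ x * Y x = -(Y x * γ x)) :
    tauDensity γ (hamField γ j) Y x = -(Matrix.trace (qs γ (j + 2) x * Y x)).re := by
  rw [tauDensity, ip, J, hamField, trace_lie_lie_mul hsq hY]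

namespace PathSpace

variable {n k : ℕ} {γ : ℝ → Mat n} (h : γ ∈ PathSpace n k)

include h

lemma rapid_hamField (j : ℕ) : Rapid fun _ => hamField γ j := by
  have := ((PathSpace.rapid_qs h (j + 1)).mul (PathSpace.tame h)).sub
    (Decays.mul_left (PathSpace.tame h) (PathSpace.rapid_qs h (j + 1)))
  exact this

lemma isTangentField_hamField (j : ℕ) : IsTangentField γ (hamField γ j) where
  smooth := (PathSpace.rapid_hamField h j).smooth.contDiff_right 0
  mem x := ⟨_, PathSpace.qs_mem h (j + 2) x, rfl⟩
  lim := (PathSpace.rapid_hamField h j).tendsto_atBot (s := 0) (by simp)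
  schwartz := (PathSpace.rapid_hamField h j).dX.isSchwartz (s := 0) (by simp)

/-- The conservation laws `∫ tr (q_i [q_j, γ]) = 0`. -/
lemma integral_trace_mul_lie (i j : ℕ) :
    ∫ x, (Matrix.trace (qs γ (i + 1) x * ⁅qs γ j x, γ x⁆)).re = 0 := by
  induction j generalizing i with
  | zero => simp [qs_zero, Ring.lie_def]
  | succ j ih =>
    have hR := (PathSpace.rapid_qs h i).mul (PathSpace.tame_qs h j)
    have hL : Rapid ((fun _ => qs γ (i + 2)) * ((fun _ => qs γ j) * (fun _ => γ) -
        (fun _ => γ) * fun _ => qs γ j)) :=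
      (PathSpace.rapid_qs h (i + 1)).mul
        (((PathSpace.tame_qs h j).mul (PathSpace.tame h)).sub
          ((PathSpace.tame h).mul (PathSpace.tame_qs h j)))
    -- Integration by parts: `[q_{j+1}, γ] = (q_j)_x`, and the derivative that falls on `q_{i+1}`
    -- produces `[q_{i+2}, γ]`. The second index drops by one until the bracket is `[γ, γ]`.
    have e : ∀ x, (Matrix.trace (qs γ (i + 1) x * ⁅qs γ (j + 1) x, γ x⁆)).re =
        (Matrix.trace (dX ((fun _ => qs γ (i + 1)) * fun _ => qs γ j) 0 x)).re +
          (Matrix.trace (qs γ (i + 2) x * ⁅qs γ j x, γ x⁆)).re := by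
      intro x
      have h1 : dX ((fun _ => qs γ (i + 1)) * fun _ => qs γ j) 0 x =
          ⁅qs γ (i + 2) x, γ x⁆ * qs γ j x + qs γ (i + 1) x * ⁅qs γ (j + 1) x, γ x⁆ :=
        ((PathSpace.hasDerivAt_qs h (i + 1) x).mul (PathSpace.hasDerivAt_qs h j x)).deriv
      have h2 : Matrix.trace (⁅qs γ (i + 2) x, γ x⁆ * qs γ j x) =
          -Matrix.trace (qs γ (i + 2) x * ⁅qs γ j x, γ x⁆) := by
        rw [Ring.lie_def, Ring.lie_def, sub_mul, mul_sub, Matrix.trace_sub, Matrix.trace_sub,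
          mul_assoc, mul_assoc, Matrix.trace_mul_comm (γ x), mul_assoc]
        ring
      rw [h1, Matrix.trace_add, h2, Complex.add_re, Complex.neg_re]
      ring
    have hI : MeasureTheory.Integrable fun x =>
        (Matrix.trace (qs γ (i + 2) x * ⁅qs γ j x, γ x⁆)).re :=
      hL.integrable_reTrace (s := 0) (by simp)
    rw [funext e, MeasureTheory.integral_add (hR.dX.integrable_reTrace (by simp)) hI, hR.integral_reTrace_dX (by simp), zero_add]
    exact ih (i + 1)

lemma tau_hamField (i j : ℕ) : MeasureTheory.Integrable
    (tauDensity γ (hamField γ i) (hamField γ j)) ∧ tau γ (hamField γ i) (hamField γ j) = 0 := by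
  have e : tauDensity γ (hamField γ i) (hamField γ j) =
      fun x => -(Matrix.trace (qs γ (i + 2) x * ⁅qs γ (j + 2) x, γ x⁆)).re :=
    funext fun x => tauDensity_hamField (PathSpace.sq h x) (lie_anticommute (PathSpace.sq h x))
  constructor
  · rw [e]
    exact (((PathSpace.rapid_qs h (i + 1)).mul
      (PathSpace.rapid_hamField h j).tame).integrable_reTrace (s := 0) (by simp)).neg
  · rw [tau, e, MeasureTheory.integral_neg, PathSpace.integral_trace_mul_lie h (i + 1) (j + 2),
      neg_zero]

lemma H_eq (j : ℕ) : H n k j γ =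
    ((j : ℝ) + 1)⁻¹ * ∫ x, (Matrix.trace (qs γ (j + 2) x * γ x)).re := by
  rw [H, F]
  simp only [PathSpace.trace_Qseq h]

lemma isHamiltonianField_hamField (j : ℕ) : IsHamiltonianField n k (H n k j) γ (hamField γ j) := by
  have hden : ∀ Γ, IsVariation n k γ Γ → tauDensity γ (hamField γ j) (velocity Γ) =
      fun x => -(Matrix.trace (dS Γ 0 x * qs γ (j + 2) x)).re := fun Γ hΓ => funext fun x => by
    have hv : velocity Γ = dS Γ 0 := rfl
    rw [hv, tauDensity_hamField (PathSpace.sq h x) (hΓ.dS_anticommute x), Matrix.trace_mul_comm]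
  refine ⟨PathSpace.isTangentField_hamField h j, fun Γ hΓ => ?_, fun Γ hΓ => ?_⟩
  · rw [hden Γ hΓ]
    have := (Decays.mul_left hΓ.tame.dS
      (rapid_qs_succ hΓ.tame hΓ.rapid_dX (j + 1))).integrable_reTrace (s := 0) (by simp)
    simp only [Pi.mul_apply, hΓ.zero] at this
    exact this.neg
  · have h1 := (hΓ.hasDerivAt_integral_trace_qs (j + 1)).const_mul ((j : ℝ) + 1)⁻¹
    rw [tau, hden Γ hΓ, MeasureTheory.integral_neg]
    convert! h1 using 1
    · funext s
      exact PathSpace.H_eq (hΓ.mem s) j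
    · have : (j : ℝ) + 1 ≠ 0 := by positivity
      push_cast
      field_simp

end PathSpace

/-! ### Compactly supported variations -/

lemma rapid_of_eq_zero {n : ℕ} {R : ℝ} {f : ℝ → ℝ → Mat n} (hf : Smooth2 f)
    (h0 : ∀ s x, R < |x| → f s x = 0) : Rapid f := by
  refine ⟨hf, fun i m p _ => ?_⟩
  have hS : ∀ i s x, R < |x| → dS^[i] f s x = 0 := by
    intro i
    induction i with
    | zero => exact h0
    | succ i ih =>
      intro s x hx
      rw [Function.iterate_succ_apply', dS, funext fun r => ih r x hx, deriv_const]
  have hX : ∀ m s x, R < |x| → dX^[m] (dS^[i] f) s x = 0 := by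
    intro m
    induction m with
    | zero => exact hS i
    | succ m ih =>
      intro s x hx
      have : dX^[m] (dS^[i] f) s =ᶠ[𝓝 x] fun _ => 0 :=
        Filter.eventually_of_mem ((isOpen_lt continuous_const continuous_abs).mem_nhds hx)
          fun y hy => ih s y hy
      rw [Function.iterate_succ_apply', dX, this.deriv_eq, deriv_const]
  have hc : Continuous fun q : ℝ × ℝ => |q.2| ^ p * ‖dX^[m] (dS^[i] f) q.1 q.2‖ :=
    (continuous_snd.abs.pow p).mul ((hf.iter_dS i).iter_dX m).continuous.norm
  obtain ⟨C, hC⟩ := ((isCompact_Icc (a := (-1 : ℝ)) (b := 1)).prod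
    (isCompact_Icc (a := -R) (b := R))).exists_bound_of_continuousOn hc.continuousOn
  refine ⟨max C 0, fun s hs x => ?_⟩
  rcases lt_or_ge R |x| with hx | hx
  · rw [hX m s x hx]
    simp
  · exact (Real.le_norm_self _).trans ((hC (s, x) ⟨hs, abs_le.1 hx⟩).trans (le_max_left _ _))

/-- The difference from the constant family is supported in a fixed compact `x`-interval, so all
bounds reduce to those of `γ_x`. -/
lemma isVariation_of_eq_of_lt {n k : ℕ} {R : ℝ} {γ : ℝ → Mat n} {Γ : ℝ → ℝ → Mat n}
    (h : γ ∈ PathSpace n k) (hΓ : Smooth2 Γ) (h0 : Γ 0 = γ) (hG : ∀ s x, Γ s x ∈ Gr n k)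
    (heq : ∀ s x, R < |x| → Γ s x = γ x) : IsVariation n k γ Γ := by
  have hγ : Smooth2 fun _ => γ := Smooth2.of_right (PathSpace.contDiff h)
  have hγ' := (isVariation_const h).rapid_dX
  have hD : Smooth2 (Γ - fun _ => γ) := hΓ.sub hγ
  refine ⟨hΓ, fun s => ⟨hΓ.contDiff_right s, hG s, ?_, ?_⟩, h0, fun i m p => ?_⟩
  · refine h.2.2.1.congr' ?_
    filter_upwards [Filter.eventually_lt_atBot (-R)] with x hx
    exact (heq s x (by linarith [neg_le_abs x])).symm
  · have h1 : Rapid fun _ : ℝ => Γ s - γ :=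
      rapid_of_eq_zero (R := R) (Smooth2.of_right (hD.contDiff_right s)) fun r x hx => by
        simp [heq s x hx]
    have h2 := (h1.dX.add hγ').isSchwartz (s := 0) (by simp)
    convert h2 using 1
    funext x
    have h3 : HasDerivAt (Γ s - γ) (deriv (Γ s) x - deriv γ x) x :=
      (hΓ.hasDerivAt_dX s x).sub (hγ.hasDerivAt_dX 0 x)
    simp [dX, h3.deriv]
  · have h1 : Rapid (Γ - fun _ => γ) := rapid_of_eq_zero (R := R) hD fun s x hx => by
      simp [heq s x hx]
    have h2 := h1.dX.add hγ'
    rw [hΓ.dX_sub hγ, sub_add_cancel] at h2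
    obtain ⟨C, hC⟩ := h2.bound i m p trivial
    refine ⟨C, fun s hs x => ?_⟩
    have := hC s hs x
    rw [hΓ.iter_dS_dX, ← Function.iterate_succ_apply, iterate_dX_apply] at this
    rw [iteratedDeriv_eq_iterate]
    convert this using 5
    funext y
    rw [iterate_dS_apply, iteratedDeriv_eq_iterate]

/-- The variation of `γ` by the conjugation with `exp (s φ z)`. -/
def expVariation {n : ℕ} (γ : ℝ → Mat n) (φ : ℝ → ℝ) (z : Mat n) : ℝ → ℝ → Mat n :=
  fun s x => NormedSpace.exp ((s * φ x) • z) * γ x * NormedSpace.exp (-(s * φ x) • z)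

lemma contDiff_exp_mat {n : ℕ} : ContDiff ℝ ∞ (NormedSpace.exp : Mat n → Mat n) :=
  contDiff_iff_contDiffAt.2 fun x => (NormedSpace.exp_analytic x).contDiffAt

section Bump

variable {n k : ℕ} {γ : ℝ → Mat n} {φ : ℝ → ℝ} {z : Mat n}

lemma isVariation_expVariation (h : γ ∈ PathSpace n k) (hφ : ContDiff ℝ ∞ φ)
    (hφ' : HasCompactSupport φ) (hz : z ∈ u n) : IsVariation n k γ (expVariation γ φ z) := by
  obtain ⟨R, hR⟩ := hφ'.isCompact.isBounded.subset_closedBall 0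
  have hzero : ∀ x, R < |x| → φ x = 0 := fun x hx => by
    by_contra hne
    have := hR (subset_tsupport φ hne)
    rw [mem_closedBall_zero_iff, Real.norm_eq_abs] at this
    linarith
  refine isVariation_of_eq_of_lt (R := R) h ?_ ?_ ?_ ?_
  · have hγ := PathSpace.contDiff h
    have e : ContDiff ℝ ∞ fun p : ℝ × ℝ => NormedSpace.exp ((p.1 * φ p.2) • z) :=
      contDiff_exp_mat.comp (by fun_prop)
    have e' : ContDiff ℝ ∞ fun p : ℝ × ℝ => NormedSpace.exp (-(p.1 * φ p.2) • z) :=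
      contDiff_exp_mat.comp (by fun_prop)
    exact (e.mul (hγ.comp contDiff_snd)).mul e'
  · funext x
    simp [expVariation]
  · intro s x
    obtain ⟨g, hg, hgx⟩ := h.2.1 x
    let _ : NormedAlgebra ℚ (Mat n) := NormedAlgebra.restrictScalars ℚ ℝ (Mat n)
    have hU : NormedSpace.exp ((s * φ x) • z) ∈ Matrix.unitaryGroup (Fin n) ℂ :=
      NormedSpace.exp_mem_unitary_of_mem_skewAdjoint (skewAdjoint.smul_mem _ hz)
    have hinv : NormedSpace.exp (-(s * φ x) • z) = star (NormedSpace.exp ((s * φ x) • z)) := by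
      rw [NormedSpace.star_exp, star_smul, skewAdjoint.mem_iff.1 hz]
      simp
    refine ⟨_, mul_mem hU hg, ?_⟩
    rw [inv_eq_star (mul_mem hU hg), expVariation, hinv, star_mul, hgx, inv_eq_star hg]
    noncomm_ring
  · intro s x hx
    simp [expVariation, hzero x hx]

lemma velocity_expVariation (x : ℝ) :
    velocity (expVariation γ φ z) x = φ x • ⁅z, γ x⁆ := by
  have h1 : HasDerivAt (fun s : ℝ => NormedSpace.exp ((s * φ x) • z)) (φ x • z) 0 := by
    have := (hasDerivAt_exp_smul_const z ((0 : ℝ) * φ x)).scomp (0 : ℝ)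
      ((hasDerivAt_id (0 : ℝ)).mul_const (φ x))
    convert! this using 1
    simp
  have h2 : HasDerivAt (fun s : ℝ => NormedSpace.exp (-(s * φ x) • z)) (-φ x • z) 0 := by
    have := (hasDerivAt_exp_smul_const z (-((0 : ℝ) * φ x))).scomp (0 : ℝ)
      ((hasDerivAt_id (0 : ℝ)).mul_const (φ x)).neg
    convert! this using 1
    simp
  have h3 := ((h1.mul_const (γ x)).mul h2).deriv
  simp only [zero_mul, neg_zero, zero_smul, NormedSpace.exp_zero, mul_one, one_mul] at h3
  refine h3.trans ?_
  rw [Ring.lie_def, smul_mul_assoc, mul_smul_comm]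
  module

end Bump

/-- For the velocity `[z, y]` of a conjugation, the symplectic pairing turns into the plain inner
product with `z`, which is free in `u(n)`. -/
lemma ip_J_lie {n : ℕ} {y v z : Mat n} (hy : y * y = -((1 / 4 : ℝ) • (1 : Mat n)))
    (hv : y * v = -(v * y)) : ip (J y v) ⁅z, y⁆ = -ip v z := by
  have h1 := trace_lie_lie_mul (q := z) hy hv
  have h2 : Matrix.trace (⁅y, v⁆ * ⁅z, y⁆) = -Matrix.trace (⁅y, ⁅z, y⁆⁆ * v) := by
    generalize ⁅z, y⁆ = w
    rw [Ring.lie_def, Ring.lie_def, sub_mul, sub_mul, Matrix.trace_sub, Matrix.trace_sub,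
      mul_assoc v, Matrix.trace_mul_comm v, mul_assoc w, Matrix.trace_mul_comm w]
    ring
  rw [ip, J, h2, h1, ip, Matrix.trace_mul_comm]
  simp

/-- The symplectic form is nondegenerate: Hamiltonian vectors are unique. -/
lemma IsHamiltonianField.unique {n k : ℕ} {γ X Y : ℝ → Mat n} {f : (ℝ → Mat n) → ℝ}
    (h : γ ∈ PathSpace n k) (hX : IsHamiltonianField n k f γ X)
    (hY : IsHamiltonianField n k f γ Y) : X = Y := by
  have hsub : ∀ V x, tauDensity γ (X - Y) V x = tauDensity γ X V x - tauDensity γ Y V x := by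
    intro V x
    simp only [tauDensity, ip, J, Pi.sub_apply, Ring.lie_def, mul_sub, sub_mul, Matrix.trace_sub,
      Complex.sub_re]
    ring
  have hanti : ∀ x, γ x * (X - Y) x = -((X - Y) x * γ x) := fun x => by
    rw [Pi.sub_apply, mul_sub, sub_mul, tangent_anticommute (PathSpace.sq h x) (hX.tangent.mem x),
      tangent_anticommute (PathSpace.sq h x) (hY.tangent.mem x)]
    abel
  have hmem : ∀ {v x}, v ∈ GrassmannFlow.tangent (γ x) → v ∈ u n := by
    rintro _ x ⟨z, hz, rfl⟩
    exact bracket_mem hz (PathSpace.mem_u h x)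
  have key : ∀ z ∈ u n, ∀ x, ip ((X - Y) x) z = 0 := by
    intro z hz
    have hc : Continuous fun x => ip ((X - Y) x) z := by
      have h1 : Continuous (X - Y) := (hX.tangent.smooth.sub hY.tangent.smooth).continuous
      exact ((reTrace n).continuous.comp (h1.mul continuous_const)).neg
    -- Fundamental lemma of the calculus of variations: the bump `φ` is the localising factor in
    -- `expVariation`, and both fields give the same derivative along it.
    have hae := ae_eq_zero_of_integral_contDiff_smul_eq_zero
      (μ := MeasureTheory.volume) hc.locallyIntegrable fun φ hφ hφ' => by
        have hv := isVariation_expVariation h hφ hφ' hz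
        have h1 := (hX.differential _ hv).unique (hY.differential _ hv)
        rw [tau, tau, ← sub_eq_zero, ← MeasureTheory.integral_sub (hX.integrable _ hv)
          (hY.integrable _ hv)] at h1
        rw [← neg_eq_zero, ← MeasureTheory.integral_neg, ← h1]
        refine MeasureTheory.integral_congr_ae (Filter.Eventually.of_forall fun x => ?_)
        have h2 := ip_J_lie (z := z) (PathSpace.sq h x) (hanti x)
        simp only [← hsub]
        rw [tauDensity, velocity_expVariation, smul_eq_mul]
        simp only [ip] at h2 ⊢
        rw [mul_smul_comm, Matrix.trace_smul, Complex.real_smul, Complex.re_ofReal_mul]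
        linear_combination -(φ x) * h2
    exact fun x => congrFun ((Continuous.ae_eq_iff_eq _ hc continuous_const).1 hae) x
  funext x
  exact sub_eq_zero.1 (eq_zero_of_ip_self
    (sub_mem (hmem (hX.tangent.mem x)) (hmem (hY.tangent.mem x)))
    (key _ (sub_mem (hmem (hX.tangent.mem x)) (hmem (hY.tangent.mem x))) x))

/-! ### Polynomials in the covariant derivatives -/

/-- All paths in all Grassmannians. -/
abbrev PathIndex : Type := Σ n k : ℕ, PathSpace n k

/-- Matrix valued functions along all paths in all Grassmannians. -/
abbrev PathFun : Type := (i : PathIndex) → ℝ → Mat i.1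

/-- The tautological function `γ`. -/
def pathPoint : PathFun := fun i => i.2.2.1

/-- The letter `∇^m_{γ_x} γ_x`. -/
def nablaLetter (m : ℕ) : PathFun := fun i => nablaPow i.2.2.1 m

/-- The letter `J_γ ∇^m_{γ_x} γ_x`. -/
def JLetter (m : ℕ) : PathFun := fun i x => J (i.2.2.1 x) (nablaPow i.2.2.1 m x)

/-- The letters of order less than `r`. -/
def letters (r : ℕ) : Fin r ⊕ Fin r → PathFun :=
  Sum.elim (fun m => nablaLetter m) fun m => JLetter m

/-- The noncommutative polynomials without constant term in the letters of order less than `r`. -/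
def pathPoly (r : ℕ) : NonUnitalSubalgebra ℝ PathFun :=
  NonUnitalAlgebra.adjoin ℝ (Set.range (letters r))

/-- Differentiation along the paths. -/
def pathDeriv (f : PathFun) : PathFun := fun i => deriv (f i)

/-- The functions `q_j` along all paths. -/
def pathQs (j : ℕ) : PathFun := fun i => qs i.2.2.1 j

lemma nablaLetter_mem {m r : ℕ} (h : m < r) : nablaLetter m ∈ pathPoly r :=
  NonUnitalAlgebra.subset_adjoin ℝ ⟨Sum.inl ⟨m, h⟩, rfl⟩

lemma JLetter_mem {m r : ℕ} (h : m < r) : JLetter m ∈ pathPoly r :=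
  NonUnitalAlgebra.subset_adjoin ℝ ⟨Sum.inr ⟨m, h⟩, rfl⟩

lemma pathPoly_mono {r r' : ℕ} (h : r ≤ r') : pathPoly r ≤ pathPoly r' := by
  refine NonUnitalAlgebra.adjoin_le ?_
  rintro _ ⟨m | m, rfl⟩
  · exact nablaLetter_mem (m.2.trans_le h)
  · exact JLetter_mem (m.2.trans_le h)

namespace PathSpace

variable {n k : ℕ} {γ : ℝ → Mat n} (h : γ ∈ PathSpace n k)

include h

lemma contDiff_nablaPow (m : ℕ) : ContDiff ℝ ∞ (nablaPow γ m) := by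
  have hγ := PathSpace.contDiff h
  induction m with
  | zero => exact (contDiff_infty_iff_deriv.1 hγ).2
  | succ m ih =>
    rw [nablaPow, Function.iterate_succ_apply']
    have h1 := (contDiff_infty_iff_deriv.1 ih).2
    have e : covDeriv γ (nablaPow γ m) = fun x => -(γ x * (γ x * deriv (nablaPow γ m) x -
        deriv (nablaPow γ m) x * γ x) - (γ x * deriv (nablaPow γ m) x -
          deriv (nablaPow γ m) x * γ x) * γ x) := rfl
    change ContDiff ℝ ∞ (covDeriv γ (nablaPow γ m))
    rw [e]
    have h2 := (hγ.mul h1).sub (h1.mul hγ)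
    exact ((hγ.mul h2).sub (h2.mul hγ)).neg

lemma nablaPow_anticommute (m : ℕ) (x : ℝ) :
    γ x * nablaPow γ m x = -(nablaPow γ m x * γ x) := by
  cases m with
  | zero =>
    have := anticommute_deriv_qs (PathSpace.contDiff h) (PathSpace.sq h) 0 x
    rwa [qs_zero] at this
  | succ m =>
    rw [nablaPow, Function.iterate_succ_apply']
    change γ x * tangentProj (γ x) _ = -(tangentProj (γ x) _ * γ x)
    have := lie_anticommute (q := ⁅γ x, deriv ((covDeriv γ)^[m] (deriv γ)) x⁆) (PathSpace.sq h x)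
    rwa [show ⁅⁅γ x, deriv ((covDeriv γ)^[m] (deriv γ)) x⁆, γ x⁆ = tangentProj (γ x) _ by
      rw [tangentProj, Ring.lie_def _ (γ x), Ring.lie_def (γ x) ⁅_, _⁆, neg_sub]] at this

lemma J_nablaPow (m : ℕ) (x : ℝ) :
    J (γ x) (nablaPow γ m x) = (2 : ℝ) • (γ x * nablaPow γ m x) := by
  rw [J, Ring.lie_def, PathSpace.nablaPow_anticommute h, two_smul]
  abel

/-- The normal part of `v_x` is `-2γ(γv_x + v_xγ)`, and differentiating `γv + vγ = 0` rewrites it as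
`2γ(γ_x v + v γ_x)`; on tangent vectors `2γ` acts as `J`. -/
lemma deriv_nablaPow (m : ℕ) (x : ℝ) : deriv (nablaPow γ m) x = nablaPow γ (m + 1) x +
    (J (γ x) (nablaPow γ 0 x) * nablaPow γ m x + J (γ x) (nablaPow γ m x) * nablaPow γ 0 x) := by
  have hγ : HasDerivAt γ (nablaPow γ 0 x) x :=
    ((PathSpace.contDiff h).differentiable (by simp) x).hasDerivAt
  have hv : HasDerivAt (nablaPow γ m) (deriv (nablaPow γ m) x) x :=
    ((PathSpace.contDiff_nablaPow h m).differentiable (by simp) x).hasDerivAt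
  have h1 : nablaPow γ 0 x * nablaPow γ m x + nablaPow γ m x * nablaPow γ 0 x =
      -(γ x * deriv (nablaPow γ m) x + deriv (nablaPow γ m) x * γ x) := by
    have h2 := (hγ.mul hv).add (hv.mul hγ)
    have h3 : (γ * nablaPow γ m + nablaPow γ m * γ) = fun _ => 0 := funext fun y => by
      simp only [Pi.add_apply, Pi.mul_apply]
      rw [PathSpace.nablaPow_anticommute h, neg_add_cancel]
    rw [h3] at h2
    have h4 := h2.unique (hasDerivAt_const _ _)
    rw [eq_neg_iff_add_eq_zero, ← h4]
    abel
  have hN : nablaPow γ (m + 1) x = tangentProj (γ x) (deriv (nablaPow γ m) x) := by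
    rw [nablaPow, Function.iterate_succ_apply']
    rfl
  rw [hN, PathSpace.J_nablaPow h, PathSpace.J_nablaPow h, smul_mul_assoc, smul_mul_assoc,
    ← smul_add, mul_assoc, mul_assoc, ← mul_add, h1, tangentProj, Ring.lie_def, Ring.lie_def]
  simp only [mul_sub, sub_mul, mul_add, mul_neg, sq_mul_of_sq (PathSpace.sq h x),
    mul_sq_of_sq (PathSpace.sq h x), mul_assoc]
  module

end PathSpace

lemma two_smul_pathPoint_mul_JLetter (m : ℕ) :
    (2 : ℝ) • (pathPoint * JLetter m) = -nablaLetter m := by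
  funext i x
  change (2 : ℝ) • (i.2.2.1 x * J (i.2.2.1 x) (nablaPow i.2.2.1 m x)) = -nablaPow i.2.2.1 m x
  rw [PathSpace.J_nablaPow i.2.2.2, mul_smul_comm, sq_mul_of_sq (PathSpace.sq i.2.2.2 x)]
  module

lemma two_smul_pathPoint_mul_nablaLetter (m : ℕ) :
    (2 : ℝ) • (pathPoint * nablaLetter m) = JLetter m := by
  funext i x
  exact (PathSpace.J_nablaPow i.2.2.2 m x).symm

/-- Left multiplication acts only on the first letter of each monomial and exchanges the two kinds
of letters up to sign. A constant term would produce `γ`, hence the non-unital algebra. -/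
lemma two_smul_pathPoint_mul_mem {r : ℕ} {f : PathFun} (hf : f ∈ pathPoly r) :
    (2 : ℝ) • (pathPoint * f) ∈ pathPoly r := by
  induction hf using NonUnitalAlgebra.adjoin_induction with
  | mem f hf =>
    obtain ⟨m | m, rfl⟩ := hf
    · change (2 : ℝ) • (pathPoint * nablaLetter m) ∈ _
      rw [two_smul_pathPoint_mul_nablaLetter]
      exact JLetter_mem m.2
    · change (2 : ℝ) • (pathPoint * JLetter m) ∈ _
      rw [two_smul_pathPoint_mul_JLetter]
      exact neg_mem (nablaLetter_mem m.2)
  | add f g _ _ hf hg => rw [mul_add, smul_add]; exact add_mem hf hg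
  | zero => simp
  | mul f g _ hg hf _ => rw [← mul_assoc, ← smul_mul_assoc]; exact mul_mem hf hg
  | smul c f _ hf => rw [mul_smul_comm, smul_comm]; exact SMulMemClass.smul_mem c hf

lemma pathDeriv_nablaLetter_mem {m r : ℕ} (h : m < r) :
    pathDeriv (nablaLetter m) ∈ pathPoly (r + 1) := by
  have e : pathDeriv (nablaLetter m) = nablaLetter (m + 1) +
      (JLetter 0 * nablaLetter m + JLetter m * nablaLetter 0) := by
    funext i x
    exact PathSpace.deriv_nablaPow i.2.2.2 m x
  rw [e]
  exact add_mem (nablaLetter_mem (by omega)) (add_mem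
    (mul_mem (JLetter_mem (by omega)) (nablaLetter_mem (by omega)))
    (mul_mem (JLetter_mem (by omega)) (nablaLetter_mem (by omega))))

lemma pathDeriv_mem {r : ℕ} {f : PathFun} (hf : f ∈ pathPoly r) :
    (∀ i, ContDiff ℝ ∞ (f i)) ∧ pathDeriv f ∈ pathPoly (r + 1) := by
  have hle : pathPoly r ≤ pathPoly (r + 1) := pathPoly_mono (by omega)
  have hdiff : ∀ {f : PathFun}, (∀ i, ContDiff ℝ ∞ (f i)) → ∀ i x,
      HasDerivAt (f i) (pathDeriv f i x) x := fun hf i x =>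
    ((hf i).differentiable (by simp) x).hasDerivAt
  induction hf using NonUnitalAlgebra.adjoin_induction with
  | mem f hf =>
    obtain ⟨m | m, rfl⟩ := hf
    · exact ⟨fun i => PathSpace.contDiff_nablaPow i.2.2.2 m, pathDeriv_nablaLetter_mem m.2⟩
    · have hs : ∀ i, ContDiff ℝ ∞ (nablaLetter m i) :=
        fun i => PathSpace.contDiff_nablaPow i.2.2.2 m
      have hp : ∀ i, ContDiff ℝ ∞ (pathPoint i) := fun i => PathSpace.contDiff i.2.2.2
      have e : pathDeriv (JLetter m) = (2 : ℝ) • (nablaLetter 0 * nablaLetter m) +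
          (2 : ℝ) • (pathPoint * pathDeriv (nablaLetter m)) := by
        rw [← two_smul_pathPoint_mul_nablaLetter, ← smul_add]
        funext i x
        exact (((hdiff hp i x).mul (hdiff hs i x)).const_smul (2 : ℝ)).deriv
      refine ⟨fun i => ?_, ?_⟩
      · change ContDiff ℝ ∞ (JLetter m i)
        rw [← two_smul_pathPoint_mul_nablaLetter]
        exact ((hp i).mul (hs i)).const_smul (2 : ℝ)
      · change pathDeriv (JLetter m) ∈ _
        rw [e]
        exact add_mem (SMulMemClass.smul_mem _
          (mul_mem (nablaLetter_mem (by omega)) (nablaLetter_mem (by omega))))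
          (two_smul_pathPoint_mul_mem (pathDeriv_nablaLetter_mem m.2))
  | add f g _ _ hf hg =>
    refine ⟨fun i => (hf.1 i).add (hg.1 i), ?_⟩
    have e : pathDeriv (f + g) = pathDeriv f + pathDeriv g := by
      funext i x
      exact ((hdiff hf.1 i x).add (hdiff hg.1 i x)).deriv
    rw [e]
    exact add_mem hf.2 hg.2
  | zero =>
    have e : pathDeriv 0 = 0 := by
      funext i x
      exact deriv_const x (0 : Mat i.1)
    exact ⟨fun i => contDiff_const, by rw [e]; exact zero_mem _⟩
  | mul f g hf' hg' hf hg =>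
    refine ⟨fun i => (hf.1 i).mul (hg.1 i), ?_⟩
    have e : pathDeriv (f * g) = pathDeriv f * g + f * pathDeriv g := by
      funext i x
      exact ((hdiff hf.1 i x).mul (hdiff hg.1 i x)).deriv
    rw [e]
    exact add_mem (mul_mem hf.2 (hle hg')) (mul_mem (hle hf') hg.2)
  | smul c f _ hf =>
    refine ⟨fun i => (hf.1 i).const_smul c, ?_⟩
    have e : pathDeriv (c • f) = c • pathDeriv f := by
      funext i x
      exact ((hdiff hf.1 i x).const_smul c).deriv
    rw [e]
    exact SMulMemClass.smul_mem c hf.2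

lemma pathQs_mem (j : ℕ) : pathQs (j + 1) ∈ pathPoly (j + 1) := by
  induction j using Nat.strong_induction_on with
  | _ j ih =>
    have e : pathQs (j + 1) = (2 : ℝ) • (pathPoint * (pathDeriv (pathQs j) +
        ∑ i ∈ Finset.range j, pathQs (i + 1) * pathQs (j - i))) := by
      funext i x
      refine (qs_succ _ j x).trans ?_
      simp only [Pi.smul_apply, Pi.mul_apply, Pi.add_apply, Finset.sum_apply]
      rfl
    rw [e]
    refine two_smul_pathPoint_mul_mem (add_mem ?_ (sum_mem fun i hi => ?_))
    · cases j with
      | zero =>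
        have e0 : pathDeriv (pathQs 0) = nablaLetter 0 := by
          funext i x
          simp only [pathDeriv, pathQs, qs_zero]
          rfl
        rw [e0]
        exact nablaLetter_mem (by omega)
      | succ j => exact (pathDeriv_mem (ih j (by omega))).2
    · have := Finset.mem_range.1 hi
      obtain ⟨l, hl⟩ : ∃ l, j - i = l + 1 := ⟨j - i - 1, by omega⟩
      rw [hl]
      exact mul_mem (pathPoly_mono (by omega) (ih i this))
        (pathPoly_mono (by omega) (ih l (by omega)))

/-- Since `f` is a function on all paths at once, the polynomial is chosen before `n`, `k` and `γ`;
evaluation at one path and one point is an algebra homomorphism. -/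
lemma exists_evalAlong_eq {r : ℕ} {f : PathFun} (hf : f ∈ pathPoly r) :
    ∃ p : FreeAlgebra ℝ (Fin r ⊕ Fin r), ∀ (n k : ℕ) (γ : ℝ → Mat n) (h : γ ∈ PathSpace n k)
      (x : ℝ), evalAlong γ x p = f ⟨n, k, γ, h⟩ x := by
  have h1 := NonUnitalAlgebra.adjoin_le_algebra_adjoin ℝ _ hf
  have h2 : f ∈ Algebra.adjoin ℝ (Set.range (letters r)) := h1
  rw [Algebra.adjoin_range_eq_range_freeAlgebra_lift] at h2
  obtain ⟨p, rfl⟩ := h2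
  refine ⟨p, fun n k γ h x => ?_⟩
  let ev : PathFun →ₐ[ℝ] Mat n := (Pi.evalAlgHom ℝ (fun _ : ℝ => Mat n) x).comp
    (Pi.evalAlgHom ℝ (fun i : PathIndex => ℝ → Mat i.1) ⟨n, k, γ, h⟩)
  have e : FreeAlgebra.lift ℝ (Sum.elim (fun m : Fin r => nablaPow γ m x)
      (fun m : Fin r => J (γ x) (nablaPow γ m x))) =
      ev.comp (FreeAlgebra.lift ℝ (letters r)) := by
    refine FreeAlgebra.hom_ext (funext fun m => ?_)
    simp only [Function.comp_apply, AlgHom.comp_apply, FreeAlgebra.lift_ι_apply]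
    rcases m with m | m <;> rfl
  exact DFunLike.congr_fun e p

/-- A density of `H_j` that is a polynomial in the covariant derivatives. -/
def hamDensity (j : ℕ) : PathFun := (-(2 * ((j : ℝ) + 1))⁻¹) •
  ∑ i ∈ Finset.range (j + 1), pathQs (i + 1) * pathQs (j + 1 - i)

lemma hamDensity_mem (j : ℕ) : hamDensity j ∈ pathPoly (j + 2) := by
  refine SMulMemClass.smul_mem _ (sum_mem fun i hi => ?_)
  have := Finset.mem_range.1 hi
  obtain ⟨l, hl⟩ : ∃ l, j + 1 - i = l + 1 := ⟨j - i, by omega⟩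
  rw [hl]
  exact mul_mem (pathPoly_mono (by omega) (pathQs_mem i))
    (pathPoly_mono (by omega) (pathQs_mem l))

/-- `tr(q_{j+2} γ)` contains `γ` itself. The quadratic relation in degree `j + 2` expresses twice
this trace through products of `q_1, …, q_{j+1}` only. -/
lemma trace_hamDensity {n k : ℕ} {γ : ℝ → Mat n} (h : γ ∈ PathSpace n k) (j : ℕ) (x : ℝ) :
    (Matrix.trace (hamDensity j ⟨n, k, γ, h⟩ x)).re =
      ((j : ℝ) + 1)⁻¹ * (Matrix.trace (qs γ (j + 2) x * γ x)).re := by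
  have h1 := sum_qs_mul_qs (PathSpace.contDiff h) (PathSpace.sq h) (j + 2) (by omega) x
  rw [Finset.sum_range_succ, Finset.sum_range_succ'] at h1
  simp only [Nat.sub_self, Nat.sub_zero, qs_zero] at h1
  have h2 : ∑ i ∈ Finset.range (j + 1), qs γ (i + 1) x * qs γ (j + 2 - (i + 1)) x =
      -(γ x * qs γ (j + 2) x + qs γ (j + 2) x * γ x) := by
    rw [eq_neg_iff_add_eq_zero, ← h1]
    abel
  have h3 : hamDensity j ⟨n, k, γ, h⟩ x = (-(2 * ((j : ℝ) + 1))⁻¹) •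
      ∑ i ∈ Finset.range (j + 1), qs γ (i + 1) x * qs γ (j + 2 - (i + 1)) x := by
    simp only [hamDensity, Pi.smul_apply, Finset.sum_apply, Pi.mul_apply]
    refine congrArg _ (Finset.sum_congr rfl fun i _ => ?_)
    rw [show j + 2 - (i + 1) = j + 1 - i by omega]
    rfl
  rw [h3, h2, Matrix.trace_smul, Matrix.trace_neg, Matrix.trace_add, Matrix.trace_mul_comm (γ x),
    Complex.real_smul, Complex.re_ofReal_mul, Complex.neg_re, Complex.add_re]
  have : (j : ℝ) + 1 ≠ 0 := by positivity
  field_simp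
  ring

/-- The Hamiltonian field is the `x`-derivative of `q_{j+1}`, so its polynomial is found by
differentiating that of `q_{j+1}`; this accounts for the letters of order up to `j + 1`. -/
lemma lie_qs_eq_deriv {n k : ℕ} {γ : ℝ → Mat n} (h : γ ∈ PathSpace n k) (j : ℕ) (x : ℝ) :
    pathDeriv (pathQs (j + 1)) ⟨n, k, γ, h⟩ x = hamField γ j x :=
  deriv_qs (PathSpace.contDiff h) (PathSpace.sq h) (j + 1) x

lemma PathSpace.integrable_trace_qs {n k : ℕ} {γ : ℝ → Mat n} (h : γ ∈ PathSpace n k) (j : ℕ) :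
    MeasureTheory.Integrable fun x => (Matrix.trace (qs γ (j + 2) x * γ x)).re :=
  ((PathSpace.rapid_qs h (j + 1)).mul (PathSpace.tame h)).integrable_reTrace (s := 0) (by simp)

end

end GrassmannFlow

/-! ### Assembly of the proposition -/

theorem proposition4p4 :
    ∃ (P : (j : ℕ) → FreeAlgebra ℝ (Fin j ⊕ Fin j))
      (R S : (j : ℕ) → FreeAlgebra ℝ (Fin (j + 2) ⊕ Fin (j + 2))),
      ∀ n k : ℕ, k ≤ n →
      (∀ γ ∈ GrassmannFlow.PathSpace n k,
        -- the frame `g`, the development `Φ(γ)` and the sequence `Q_j(Φ(γ))` are well defined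
        (∃! g, GrassmannFlow.IsFrame n k γ g) ∧
        (∃! Q, GrassmannFlow.IsHierarchy n k (GrassmannFlow.Phi n k γ) Q) ∧
        -- `g Q_j(Φ(γ)) g⁻¹` is a polynomial in the covariant derivatives of order at most `j - 1`
        (∀ j, 1 ≤ j → ∀ x,
          GrassmannFlow.frame n k γ x *
              GrassmannFlow.Qseq n k (GrassmannFlow.Phi n k γ) j x *
              (GrassmannFlow.frame n k γ x)⁻¹ =
            GrassmannFlow.evalAlong γ x (P j)) ∧
        -- the Hamiltonians
        (∀ j,
          MeasureTheory.Integrable (fun x => (Matrix.trace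
            (GrassmannFlow.Qseq n k (GrassmannFlow.Phi n k γ) (j + 2) x *
              GrassmannFlow.base n k)).re) ∧
          MeasureTheory.Integrable
            (fun x => (Matrix.trace (GrassmannFlow.evalAlong γ x (R j))).re) ∧
          GrassmannFlow.H n k j γ =
            ∫ x, (Matrix.trace (GrassmannFlow.evalAlong γ x (R j))).re) ∧
        -- their Hamiltonian vector fields
        (∀ j X, GrassmannFlow.IsHamiltonianField n k (GrassmannFlow.H n k j) γ X ↔
          X = fun x => GrassmannFlow.evalAlong γ x (S j)) ∧
        (∀ j x, GrassmannFlow.evalAlong γ x (S j) =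
          GrassmannFlow.frame n k γ x *
            ⁅GrassmannFlow.Qseq n k (GrassmannFlow.Phi n k γ) (j + 2) x,
              GrassmannFlow.base n k⁆ *
            (GrassmannFlow.frame n k γ x)⁻¹) ∧
        -- the Hamiltonians Poisson commute
        (∀ (i j : ℕ) (X Y : ℝ → GrassmannFlow.Mat n),
          GrassmannFlow.IsHamiltonianField n k (GrassmannFlow.H n k i) γ X →
          GrassmannFlow.IsHamiltonianField n k (GrassmannFlow.H n k j) γ Y →
          MeasureTheory.Integrable (GrassmannFlow.tauDensity γ X Y) ∧
          GrassmannFlow.tau γ X Y = 0)) ∧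
      -- their flows
      (∀ (j : ℕ) (I : Set ℝ) (Γ : ℝ → ℝ → GrassmannFlow.Mat n),
        (∀ t ∈ I, Γ t ∈ GrassmannFlow.PathSpace n k) →
        (GrassmannFlow.IsHamiltonianFlow n k (GrassmannFlow.H n k j) I Γ ↔
          ∀ t ∈ I, ∀ x, HasDerivAt (fun s => Γ s x)
            (GrassmannFlow.evalAlong (Γ t) x (S j)) t)) := by
  have hP : ∀ j, ∃ p : FreeAlgebra ℝ (Fin j ⊕ Fin j), 1 ≤ j → ∀ (n k : ℕ)
      (γ : ℝ → GrassmannFlow.Mat n), γ ∈ GrassmannFlow.PathSpace n k → ∀ x,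
      GrassmannFlow.evalAlong γ x p = GrassmannFlow.qs γ j x := by
    intro j
    cases j with
    | zero => exact ⟨0, by omega⟩
    | succ j =>
      obtain ⟨p, hp⟩ := GrassmannFlow.exists_evalAlong_eq (GrassmannFlow.pathQs_mem j)
      exact ⟨p, fun _ => hp⟩
  choose P hP using hP
  choose R hR using fun j =>
    GrassmannFlow.exists_evalAlong_eq (GrassmannFlow.hamDensity_mem j)
  choose S hS using fun j =>
    GrassmannFlow.exists_evalAlong_eq (GrassmannFlow.pathDeriv_mem (GrassmannFlow.pathQs_mem j)).2
  simp only [GrassmannFlow.lie_qs_eq_deriv] at hS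
  have hField : ∀ (n k j : ℕ) (γ : ℝ → GrassmannFlow.Mat n), γ ∈ GrassmannFlow.PathSpace n k →
      ∀ X, GrassmannFlow.IsHamiltonianField n k (GrassmannFlow.H n k j) γ X ↔
        X = fun x => GrassmannFlow.evalAlong γ x (S j) := by
    intro n k j γ h X
    rw [funext (hS j n k γ h)]
    have h1 := GrassmannFlow.PathSpace.isHamiltonianField_hamField h j
    exact ⟨fun hX => hX.unique h h1, fun hX => hX ▸ h1⟩
  refine ⟨P, R, S, fun n k _ => ⟨fun γ h => ⟨GrassmannFlow.PathSpace.existsUnique_frame h,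
    GrassmannFlow.PathSpace.existsUnique_hierarchy h, fun j hj x => ?_, fun j => ?_,
    fun j => hField n k j γ h, fun j x => ?_, fun i j X Y hX hY => ?_⟩, fun j I Γ hΓ => ?_⟩⟩
  · rw [GrassmannFlow.PathSpace.conj_Qseq h, hP j hj n k γ h]
  · have hI := GrassmannFlow.PathSpace.integrable_trace_qs h j
    simp only [GrassmannFlow.PathSpace.trace_Qseq h, hR j n k γ h,
      GrassmannFlow.trace_hamDensity h]
    exact ⟨hI, hI.const_mul _, by
      rw [GrassmannFlow.PathSpace.H_eq h, MeasureTheory.integral_const_mul]⟩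
  · rw [hS j n k γ h, GrassmannFlow.PathSpace.conj_Qseq_lie h]
    rfl
  · rw [hField n k i γ h, funext (hS i n k γ h)] at hX
    rw [hField n k j γ h, funext (hS j n k γ h)] at hY
    rw [hX, hY]
    exact GrassmannFlow.PathSpace.tau_hamField h i j
  · constructor
    · intro hF t ht x
      obtain ⟨-, X, hX, hd⟩ := hF t ht
      rw [hField n k j (Γ t) (hΓ t ht)] at hX
      simpa only [hX] using hd x
    · intro hd t ht
      exact ⟨hΓ t ht, _, (hField n k j (Γ t) (hΓ t ht) _).2 rfl, hd t ht⟩
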